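/- Let $V$ be a real function on $\mathbb{Z}$ (resp. on $\mathbb{N}=\{1,2,\dots\}$), and let $H$ be the self-adjoint operator in $\ell^2(\mathbb{Z})$ (resp. $\ell^2(\mathbb{N})$, with Dirichlet boundary condition at $0$) given on its natural domain $\{\psi\in\ell^2 : H\psi\in\ell^2\}$ by $(H\psi)(n)=\psi(n-1)+\psi(n+1)+V(n)\psi(n)$ (in the half-line case $\psi(0)=0$, that is, $(H\psi)(1)=\psi(2)+V(1)\psi(1)$). For $z\in\mathbb{C}$ put $$A(n,z)=\begin{pmatrix} z-V(n) & -1\\ 1 & 0\end{pmatrix},$$ and let $T(n,m;z)=A(n,z)A(n-1,z)\cdots A(m+1,z)$ if $n>m$, $T(n,n;z)=I$, and $T(n,m;z)=T(m,n;z)^{-1}$ if $n<m$. Let $\|\cdot\|$ be the operator norm of $2\times2$ matrices for the Euclidean norm. For $p>0$ and $T>0$ define $$a(n,T)=\frac1T\int_0^\infty e^{-2t/T}\,|\langle e^{-itH}\delta_1,\delta_n\rangle|^2\,dt,\qquad \langle|X|^p\rangle(T)=\sum_n|n|^p\,a(n,T),$$ $$\beta^-(p)=\liminf_{T\to+\infty}\frac{\log\langle|X|^p\rangle(T)}{\log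 T}.$$ Suppose that there exist $C>0$, $E_0\in\mathbb{R}$ and $\theta\ge1$ such that $$\|T(n,1;E)\|\le C$$ for all $E\in\mathbb{R}$ and all $n\in\mathbb{Z}\setminus\{0\}$ (resp. all $n\in\mathbb{N}$) with $|n|\cdot|E-E_0|^{\theta}\le1$. Then for every $p>0$, $$\beta^-(p)\ge p-\frac1\theta .$$ -/

import Mathlib

open Filter MeasureTheory
open scoped ENNReal Matrix.Norms.L2Operator

noncomputable section

/-! ### Formal Schrödinger operators on the line and on the half-line -/

/-- The formal operator `(τu)(n) = u(n-1) + u(n+1) + V(n)u(n)` on sequences indexed by `ℤ`. -/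
def lineExpr (V : ℤ → ℝ) : (ℤ → ℂ) →ₗ[ℂ] (ℤ → ℂ) where
  toFun u n := u (n - 1) + u (n + 1) + (V n : ℂ) * u n
  map_add' u v := by ext n; simp only [Pi.add_apply]; ring
  map_smul' c u := by ext n; simp only [Pi.smul_apply, smul_eq_mul, RingHom.id_apply]; ring

/-- The formal operator on sequences indexed by `{1, 2, …}` with Dirichlet boundary condition
at `0`: `(τu)(n) = u(n-1) + u(n+1) + V(n)u(n)` for `n > 1`, and `(τu)(1) = u(2) + V(1)u(1)`. -/
def halfLineExpr (V : ℕ+ → ℝ) : (ℕ+ → ℂ) →ₗ[ℂ] (ℕ+ → ℂ) where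
  toFun u n := (if n = 1 then 0 else u (n - 1)) + u (n + 1) + (V n : ℂ) * u n
  map_add' u v := by ext n; simp only [Pi.add_apply]; split_ifs <;> ring
  map_smul' c u := by
    ext n; simp only [Pi.smul_apply, smul_eq_mul, RingHom.id_apply]; split_ifs <;> ring

/-- The Hilbert space `ℓ²(ι)` of square summable complex families. -/
abbrev EllTwo (ι : Type) : Type := lp (fun _ : ι => ℂ) 2

/-- The operator in `ℓ²(ι)` given by a formal operator `τ` on its natural domain
`{ψ ∈ ℓ²(ι) : τψ ∈ ℓ²(ι)}`. -/
def ellTwoOperator {ι : Type} (τ : (ι → ℂ) →ₗ[ℂ] (ι → ℂ)) : EllTwo ι →ₗ.[ℂ] EllTwo ι where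
  domain :=
    { carrier := {ψ | Memℓp (τ ψ) 2}
      add_mem' := by
        intro a b ha hb
        simp only [Set.mem_ofPred_eq, lp.coeFn_add, map_add] at *
        exact ha.add hb
      zero_mem' := by
        simp only [Set.mem_ofPred_eq, lp.coeFn_zero, map_zero]
        exact zero_memℓp
      smul_mem' := by
        intro c a ha
        simp only [Set.mem_ofPred_eq, lp.coeFn_smul, map_smul] at *
        exact ha.const_smul c }
  toFun :=
    { toFun := fun ψ => ⟨τ (ψ : EllTwo ι), ψ.2⟩
      map_add' := fun a b => by ext1; exact map_add τ _ _
      map_smul' := fun c a => by ext1; exact map_smul τ _ _ }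

/-- The Schrödinger operator `H` in `ℓ²(ℤ)` with potential `V`. -/
def lineOperator (V : ℤ → ℝ) : EllTwo ℤ →ₗ.[ℂ] EllTwo ℤ := ellTwoOperator (lineExpr V)

/-- The Schrödinger operator `H` in `ℓ²({1, 2, …})` with potential `V`. -/
def halfLineOperator (V : ℕ+ → ℝ) : EllTwo ℕ+ →ₗ.[ℂ] EllTwo ℕ+ := ellTwoOperator (halfLineExpr V)

/-! ### The unitary group `exp(-itH)` -/

section Group

variable {𝓗 : Type} [NormedAddCommGroup 𝓗] [InnerProductSpace ℂ 𝓗]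

/-- `U` is the strongly continuous one-parameter unitary group `t ↦ exp(-itH)`, that is, the one
whose infinitesimal generator is exactly `-iH` (domain included). -/
structure IsUnitaryGroupOf (H : 𝓗 →ₗ.[ℂ] 𝓗) (U : ℝ → 𝓗 →L[ℂ] 𝓗) : Prop where
  map_zero : U 0 = ContinuousLinearMap.id ℂ 𝓗
  map_add : ∀ s t : ℝ, U (s + t) = (U s).comp (U t)
  norm_map : ∀ (t : ℝ) (ψ : 𝓗), ‖U t ψ‖ = ‖ψ‖
  continuous : ∀ ψ : 𝓗, Continuous fun t : ℝ => U t ψ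
  generator : ∀ ψ φ : 𝓗,
    (ψ, φ) ∈ H.graph ↔ HasDerivAt (fun t : ℝ => U t ψ) (-(Complex.I • φ)) 0

open Classical in
/-- The unitary group `t ↦ exp(-itH)`. By Stone's theorem it exists exactly when `H` is
self-adjoint (and densely defined), and it is then unique. -/
def unitaryGroup (H : 𝓗 →ₗ.[ℂ] 𝓗) : ℝ → 𝓗 →L[ℂ] 𝓗 :=
  if h : ∃ U, IsUnitaryGroupOf H U then h.choose else fun _ => 0

theorem unitaryGroup_spec {H : 𝓗 →ₗ.[ℂ] 𝓗} (h : ∃ U, IsUnitaryGroupOf H U) :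
    IsUnitaryGroupOf H (unitaryGroup H) := by
  rw [unitaryGroup, dif_pos h]
  exact h.choose_spec

theorem IsUnitaryGroupOf.hasDerivAt {H : 𝓗 →ₗ.[ℂ] 𝓗} {U : ℝ → 𝓗 →L[ℂ] 𝓗}
    (hU : IsUnitaryGroupOf H U) {ψ φ : 𝓗} (h : (ψ, φ) ∈ H.graph) (t : ℝ) :
    HasDerivAt (fun s : ℝ => U s ψ) (-(Complex.I • U t φ)) t := by
  have h0 := (hU.generator ψ φ).1 h
  have h1 : HasDerivAt (fun s : ℝ => U (s - t) ψ) (-(Complex.I • φ)) t := by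
    have : HasDerivAt (fun s : ℝ => U s ψ) (-(Complex.I • φ)) ((fun s => s - t) t) := by
      simpa using h0
    have h := HasDerivAt.scomp (h := fun s : ℝ => s - t) t this
      ((hasDerivAt_id' t).sub_const t)
    rwa [one_smul] at h
  have h2 := ((U t).restrictScalars ℝ).hasFDerivAt.comp_hasDerivAt t h1
  have e : (fun s : ℝ => U s ψ) = ((U t).restrictScalars ℝ) ∘ fun s : ℝ => U (s - t) ψ := by
    funext s
    have := congrArg (fun A => A ψ) (hU.map_add t (s - t))
    simpa using this
  rw [e]
  simpa using h2

theorem IsUnitaryGroupOf.map_graph {H : 𝓗 →ₗ.[ℂ] 𝓗} {U : ℝ → 𝓗 →L[ℂ] 𝓗}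
    (hU : IsUnitaryGroupOf H U) {ψ φ : 𝓗} (h : (ψ, φ) ∈ H.graph) (t : ℝ) :
    (U t ψ, U t φ) ∈ H.graph := by
  rw [hU.generator]
  have h2 := ((U t).restrictScalars ℝ).hasFDerivAt.comp_hasDerivAt 0 ((hU.generator ψ φ).1 h)
  have e : (fun s : ℝ => U s (U t ψ)) = ((U t).restrictScalars ℝ) ∘ fun s : ℝ => U s ψ := by
    funext s
    have h3 := congrArg (fun A => A ψ) (hU.map_add t s)
    have h4 := congrArg (fun A => A ψ) (hU.map_add s t)
    rw [add_comm t s] at h3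
    exact h4.symm.trans h3
  rw [e]
  simpa using h2

/-- The evolution of a state in the domain of `H` does not depend on the choice of the group. -/
theorem IsUnitaryGroupOf.unique {H : 𝓗 →ₗ.[ℂ] 𝓗} {U U' : ℝ → 𝓗 →L[ℂ] 𝓗}
    (hU : IsUnitaryGroupOf H U) (hU' : IsUnitaryGroupOf H U') {ψ : 𝓗} (h : ψ ∈ H.domain) (t : ℝ) :
    U t ψ = U' t ψ := by
  obtain ⟨φ, hφ⟩ : ∃ φ, (ψ, φ) ∈ H.graph := ⟨H ⟨ψ, h⟩, H.mem_graph ⟨ψ, h⟩⟩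
  let _ : InnerProductSpace ℝ 𝓗 := InnerProductSpace.complexToReal
  have key : ∀ x y : 𝓗, (x, y) ∈ H.graph → inner ℝ x (-(Complex.I • y)) = 0 := by
    intro x y hxy
    have h1 := ((hU.generator x y).1 hxy).norm_sq
    have h2 : (fun s : ℝ => ‖U s x‖ ^ 2) = fun _ => ‖x‖ ^ 2 := by
      funext s; rw [hU.norm_map]
    rw [h2] at h1
    have h3 := h1.unique (hasDerivAt_const (0 : ℝ) (‖x‖ ^ 2))
    simpa [hU.map_zero] using h3
  have hd : ∀ s : ℝ, HasDerivAt (fun s : ℝ => ‖U s ψ - U' s ψ‖ ^ 2) 0 s := by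
    intro s
    have h1 := ((hU.hasDerivAt hφ s).sub (hU'.hasDerivAt hφ s)).norm_sq
    have h2 := key _ _ (H.graph.sub_mem (hU.map_graph hφ s) (hU'.map_graph hφ s))
    have h3 : -(Complex.I • U s φ) - -(Complex.I • U' s φ)
        = -(Complex.I • (U s φ - U' s φ)) := by rw [smul_sub]; abel
    rw [h3] at h1
    have h4 : inner ℝ (U s ψ - U' s ψ) (-(Complex.I • (U s φ - U' s φ))) = 0 := h2
    simpa [h4] using h1
  have hc := is_const_of_deriv_eq_zero (fun s => (hd s).differentiableAt) (fun s => (hd s).deriv)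
    t 0
  simp only [hU.map_zero, hU'.map_zero, sub_self] at hc
  have : ‖U t ψ - U' t ψ‖ = 0 := by simpa using hc
  exact sub_eq_zero.1 (norm_eq_zero.1 this)

end Group

/-! ### Time-averaged moments and the growth exponent -/

section Moments

variable {ι : Type} [DecidableEq ι]

/-- `ψ(t, n)`, the `n`-th coordinate of `exp(-itH) δ_o`. -/
def amplitude (H : EllTwo ι →ₗ.[ℂ] EllTwo ι) (o : ι) (t : ℝ) (n : ι) : ℂ :=
  unitaryGroup H t (lp.single 2 o (1 : ℂ)) n

/-- `a(n, T) = (1/T) ∫₀^∞ exp(-2t/T) |ψ(t, n)|² dt`. -/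
def timeAverage (H : EllTwo ι →ₗ.[ℂ] EllTwo ι) (o : ι) (n : ι) (T : ℝ) : ℝ≥0∞ :=
  ENNReal.ofReal (1 / T) *
    ∫⁻ t in Set.Ioi (0 : ℝ), ENNReal.ofReal (Real.exp (-2 * t / T) * ‖amplitude H o t n‖ ^ 2)

/-- `⟨|X|^p⟩(T) = ∑ₙ |n|^p a(n, T)`, where `pos n` is the position `n` as an integer. -/
def moment (H : EllTwo ι →ₗ.[ℂ] EllTwo ι) (o : ι) (pos : ι → ℤ) (p T : ℝ) : ℝ≥0∞ :=
  ∑' n : ι, ENNReal.ofReal (|(pos n : ℝ)| ^ p) * timeAverage H o n T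

/-- `β⁻(p) = liminf_{T → ∞} log ⟨|X|^p⟩(T) / log T`, an extended real number. -/
def betaMinus (H : EllTwo ι →ₗ.[ℂ] EllTwo ι) (o : ι) (pos : ι → ℤ) (p : ℝ) : EReal :=
  liminf (fun T : ℝ => ENNReal.log (moment H o pos p T) / ((Real.log T : ℝ) : EReal)) atTop

end Moments

/-- `β⁻(p)` for the operator in `ℓ²(ℤ)` with potential `V` and the initial state `δ₁`. -/
def lineBetaMinus (V : ℤ → ℝ) (p : ℝ) : EReal :=
  betaMinus (lineOperator V) 1 (fun n : ℤ => n) p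

/-- `β⁻(p)` for the operator in `ℓ²({1, 2, …})` with potential `V` and the initial state `δ₁`. -/
def halfLineBetaMinus (V : ℕ+ → ℝ) (p : ℝ) : EReal :=
  betaMinus (halfLineOperator V) 1 (fun n : ℕ+ => (n : ℤ)) p

/-! ### Transfer matrices -/

/-- The one-step matrix `A(n, z)`. -/
def stepMatrix (V : ℤ → ℝ) (n : ℤ) (z : ℂ) : Matrix (Fin 2) (Fin 2) ℂ :=
  !![z - (V n : ℂ), -1; 1, 0]

/-- `A(m+k, z) A(m+k-1, z) ⋯ A(m+1, z)`. -/
def stepProd (V : ℤ → ℝ) (m : ℤ) (z : ℂ) : ℕ → Matrix (Fin 2) (Fin 2) ℂ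
  | 0 => 1
  | k + 1 => stepMatrix V (m + (k + 1 : ℕ)) z * stepProd V m z k

/-- The transfer matrix `T(n, m; z)`: `A(n, z) ⋯ A(m+1, z)` for `n > m`, the identity for
`n = m`, and `T(m, n; z)⁻¹` for `n < m`. -/
def transferMatrix (V : ℤ → ℝ) (n m : ℤ) (z : ℂ) : Matrix (Fin 2) (Fin 2) ℂ :=
  if m ≤ n then stepProd V m z (n - m).toNat else (stepProd V n z (m - n).toNat)⁻¹

/-- The transfer matrix `T(n, m; z)` of a potential on `{1, 2, …}`, for `n, m ≥ 1`; only the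
values of the potential at sites `> 1` enter, so the extension by `0` plays no role. -/
def halfLineTransferMatrix (V : ℕ+ → ℝ) (n m : ℕ+) (z : ℂ) : Matrix (Fin 2) (Fin 2) ℂ :=
  transferMatrix (Function.extend (fun k : ℕ+ => (k : ℤ)) V 0) n m z

end

/-
A Laplace transform at the complex energy `z = E + i/T` turns the evolution `e^{-itH} δ₁` into the
solution `u` of `τu = zu - iδ₁`, and by Plancherel's theorem in `t` the average `a(n, T)` is
`(1 / 2πT) ∫ |u(n)|² dE`. The source at the site `1` forces `u` to be of order `1` on one of its
two sides. On that side, variation of constants for the reduced vector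
`T(n, 1; E)⁻¹ (u(n + 1), u(n))` and Grönwall's inequality compare `u` with a solution at the real
energy `E`, so that `u` stays of order `1` at all sites `|n| ≤ T` as long as `‖T(n, 1; E)‖ ≤ C`
there. The hypothesis grants this for `|E - E₀| ≤ T^{-1/θ}`, and the sites at distance about `T`
from the origin then contribute at least a constant times `T^p · T^{-1} · T · T^{-1/θ}` to the
moment.
-/

noncomputable section

section LinearODE

variable {𝕜 E : Type*} [NontriviallyNormedField 𝕜] [NormedAddCommGroup E] [NormedSpace 𝕜 E]
  {A : ℝ → E →L[𝕜] E} {b : ℝ}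

theorem continuous_clm_apply_of_bounded {X F : Type*} [TopologicalSpace X] [NormedAddCommGroup F]
    [NormedSpace 𝕜 F] {A : X → E →L[𝕜] F} (hb : ∀ t, ‖A t‖ ≤ b)
    (hA : ∀ x, Continuous fun t => A t x) {f : X → E} (hf : Continuous f) :
    Continuous fun t => A t (f t) := by
  refine continuous_iff_continuousAt.2 fun t => ?_
  have hsub : Tendsto (fun s => A s (f s - f t)) (nhds t) (nhds 0) := by
    have hlim : Tendsto (fun s => b * ‖f s - f t‖) (nhds t) (nhds 0) := by
      have : Continuous fun s => b * ‖f s - f t‖ := by fun_prop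
      simpa using this.tendsto t
    exact squeeze_zero_norm (fun s => (A s).le_of_opNorm_le (hb s) _) hlim
  simpa [ContinuousAt] using hsub.add ((hA (f t)).tendsto t)

variable [NormedSpace ℝ E]

/-- The terms of the Dyson series of `φ' = A(t) φ`, `φ(0) = x`, defined by Picard iteration. -/
def dysonTerm (A : ℝ → E →L[𝕜] E) (x : E) : ℕ → ℝ → E
  | 0 => fun _ => x
  | k + 1 => fun t => ∫ s in (0 : ℝ)..t, A s (dysonTerm A x k s)

/-- The Dyson series, the solution of `φ' = A(t) φ`, `φ(0) = x`. -/
def dysonSeries (A : ℝ → E →L[𝕜] E) (x : E) (t : ℝ) : E := ∑' k, dysonTerm A x k t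

theorem norm_dysonTerm_le (hb : ∀ t, ‖A t‖ ≤ b) (x : E) (k : ℕ) (t : ℝ) :
    ‖dysonTerm A x k t‖ ≤ (b * |t|) ^ k / k.factorial * ‖x‖ := by
  induction k generalizing t with
  | zero => simp [dysonTerm]
  | succ k ih =>
    have hbound : ∀ s, ‖A s (dysonTerm A x k s)‖ ≤
        b ^ (k + 1) / k.factorial * ‖x‖ * |s| ^ k := fun s =>
      calc _ ≤ b * ((b * |s|) ^ k / k.factorial * ‖x‖) :=
            (A s).le_of_opNorm_le_of_le (hb s) (ih s)
        _ = _ := by rw [mul_pow]; ring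
    calc ‖dysonTerm A x (k + 1) t‖
        ≤ ∫ s in Set.uIoc 0 t, b ^ (k + 1) / k.factorial * ‖x‖ * |s - 0| ^ k := by
          rw [dysonTerm, intervalIntegral.norm_integral_eq_norm_integral_uIoc]
          refine norm_integral_le_of_norm_le ?_ (ae_of_all _ fun s => by simpa using hbound s)
          exact (Continuous.integrableOn_uIcc (by fun_prop)).mono_set Set.uIoc_subset_uIcc
      _ = (b * |t|) ^ (k + 1) / (k + 1).factorial * ‖x‖ := by
          rw [integral_const_mul, integral_pow_abs_sub_uIoc, sub_zero, mul_pow,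
            Nat.factorial_succ]
          push_cast
          field_simp

theorem summable_dysonTerm [CompleteSpace E] (hb : ∀ t, ‖A t‖ ≤ b) (x : E) (t : ℝ) :
    Summable fun k => dysonTerm A x k t :=
  .of_norm_bounded ((Real.summable_pow_div_factorial (b * |t|)).mul_right ‖x‖)
    fun k => norm_dysonTerm_le hb x k t

theorem dysonSeries_eq_add_tsum [CompleteSpace E] (hb : ∀ t, ‖A t‖ ≤ b) (x : E) (t : ℝ) :
    dysonSeries A x t = x + ∑' k, dysonTerm A x (k + 1) t :=
  (summable_dysonTerm hb x t).tsum_eq_zero_add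

theorem dysonSeries_zero [CompleteSpace E] (hb : ∀ t, ‖A t‖ ≤ b) (x : E) :
    dysonSeries A x 0 = x := by
  simp [dysonSeries_eq_add_tsum hb, dysonTerm]

theorem continuous_dysonTerm (hb : ∀ t, ‖A t‖ ≤ b) (hA : ∀ x, Continuous fun t => A t x)
    (x : E) (k : ℕ) : Continuous (dysonTerm A x k) := by
  induction k with
  | zero => exact continuous_const
  | succ k ih =>
    exact intervalIntegral.continuous_primitive
      (fun _ _ => (continuous_clm_apply_of_bounded hb hA ih).intervalIntegrable _ _) 0

theorem hasDerivAt_dysonTerm_succ [CompleteSpace E] (hb : ∀ t, ‖A t‖ ≤ b)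
    (hA : ∀ x, Continuous fun t => A t x) (x : E) (k : ℕ) (t : ℝ) :
    HasDerivAt (dysonTerm A x (k + 1)) (A t (dysonTerm A x k t)) t :=
  ((continuous_clm_apply_of_bounded hb hA
    (continuous_dysonTerm hb hA x k)).integral_hasStrictDerivAt 0 t).hasDerivAt

theorem hasDerivAt_dysonSeries [CompleteSpace E] (hb : ∀ t, ‖A t‖ ≤ b)
    (hA : ∀ x, Continuous fun t => A t x) (x : E) (t : ℝ) :
    HasDerivAt (dysonSeries A x) (A t (dysonSeries A x t)) t := by
  have hb0 : 0 ≤ b := (norm_nonneg _).trans (hb 0)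
  set R : ℝ := |t| + 1 with hR
  have ht : t ∈ Metric.ball (0 : ℝ) R := by simp [hR]
  have hterm : ∀ k, ∀ s ∈ Metric.ball (0 : ℝ) R,
      ‖A s (dysonTerm A x k s)‖ ≤ b * ((b * R) ^ k / k.factorial * ‖x‖) := by
    intro k s hs
    have hsR : |s| ≤ R := by simpa using (Metric.mem_ball.1 hs).le
    refine (A s).le_of_opNorm_le_of_le (hb s) ((norm_dysonTerm_le hb x k s).trans ?_)
    gcongr
  have hderiv := hasDerivAt_tsum_of_isPreconnected
    (((Real.summable_pow_div_factorial (b * R)).mul_right ‖x‖).mul_left b)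
    Metric.isOpen_ball (convex_ball (0 : ℝ) R).isPreconnected
    (fun k s _ => hasDerivAt_dysonTerm_succ hb hA x k s) hterm ht
    ((summable_nat_add_iff 1).2 (summable_dysonTerm hb x t)) ht
  rw [← (A t).map_tsum (summable_dysonTerm hb x t)] at hderiv
  exact (hderiv.const_add x).congr_of_eventuallyEq (.of_forall (dysonSeries_eq_add_tsum hb x))

theorem eq_dysonSeries [CompleteSpace E] (hb : ∀ t, ‖A t‖ ≤ b)
    (hA : ∀ x, Continuous fun t => A t x) {φ : ℝ → E} (hφ : ∀ t, HasDerivAt φ (A t (φ t)) t) :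
    φ = dysonSeries A (φ 0) := by
  refine ODE_solution_unique_univ (v := fun t x => A t x) (s := fun _ => Set.univ)
    (K := b.toNNReal) (t₀ := 0) (fun t => ?_) (fun t => ⟨hφ t, trivial⟩)
    (fun t => ⟨hasDerivAt_dysonSeries hb hA _ t, trivial⟩) (dysonSeries_zero hb _).symm
  refine ((A t).lipschitz.weaken ?_).lipschitzOnWith
  exact NNReal.coe_le_coe.1 ((hb t).trans (Real.le_coe_toNNReal b))

theorem dysonSeries_add [CompleteSpace E] (hb : ∀ t, ‖A t‖ ≤ b)
    (hA : ∀ x, Continuous fun t => A t x) (x y : E) :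
    dysonSeries A (x + y) = dysonSeries A x + dysonSeries A y := by
  have h := eq_dysonSeries hb hA (φ := dysonSeries A x + dysonSeries A y) fun t =>
    ((hasDerivAt_dysonSeries hb hA x t).add (hasDerivAt_dysonSeries hb hA y t)).congr_deriv
      (map_add (A t) _ _).symm
  rw [h, Pi.add_apply, dysonSeries_zero hb, dysonSeries_zero hb]

theorem dysonSeries_smul [CompleteSpace E] [SMulCommClass ℝ 𝕜 E] (hb : ∀ t, ‖A t‖ ≤ b)
    (hA : ∀ x, Continuous fun t => A t x) (c : 𝕜) (x : E) :
    dysonSeries A (c • x) = c • dysonSeries A x := by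
  have h := eq_dysonSeries hb hA (φ := c • dysonSeries A x) fun t =>
    ((hasDerivAt_dysonSeries hb hA x t).const_smul c).congr_deriv (map_smul (A t) _ _).symm
  rw [h, Pi.smul_apply, dysonSeries_zero hb]

end LinearODE

section Perturbation

theorem norm_eq_of_hasDerivAt_of_inner_eq_zero {E : Type*} [NormedAddCommGroup E]
    [InnerProductSpace ℝ E] {f f' : ℝ → E} (hf : ∀ t, HasDerivAt f (f' t) t)
    (horth : ∀ t, inner ℝ (f t) (f' t) = 0) (s t : ℝ) : ‖f s‖ = ‖f t‖ := by
  have hderiv : ∀ t, HasDerivAt (fun t => ‖f t‖ ^ 2) 0 t := fun t => by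
    simpa [horth t] using (hf t).norm_sq
  have hconst := is_const_of_deriv_eq_zero (fun t => (hderiv t).differentiableAt)
    (fun t => (hderiv t).deriv) s t
  exact (sq_eq_sq₀ (norm_nonneg _) (norm_nonneg _)).1 hconst

variable {𝓗 : Type} [NormedAddCommGroup 𝓗] [InnerProductSpace ℂ 𝓗] {H₀ H : 𝓗 →ₗ.[ℂ] 𝓗}
  {D : ℝ → 𝓗 →L[ℂ] 𝓗} {B : 𝓗 →L[ℂ] 𝓗}

theorem IsUnitaryGroupOf.apply_apply (hD : IsUnitaryGroupOf H₀ D) (s t : ℝ) (ψ : 𝓗) :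
    D s (D t ψ) = D (s + t) ψ := by
  rw [hD.map_add]; rfl

theorem IsUnitaryGroupOf.apply_neg_apply (hD : IsUnitaryGroupOf H₀ D) (t : ℝ) (ψ : 𝓗) :
    D t (D (-t) ψ) = ψ := by
  simp [hD.apply_apply, hD.map_zero]

theorem IsUnitaryGroupOf.inner_map_map (hD : IsUnitaryGroupOf H₀ D) (t : ℝ) (ψ φ : 𝓗) :
    inner ℂ (D t ψ) (D t φ) = inner ℂ ψ φ :=
  (LinearIsometry.mk (D t).toLinearMap (hD.norm_map t)).inner_map_map ψ φ

theorem IsUnitaryGroupOf.opNorm_le_one (hD : IsUnitaryGroupOf H₀ D) (t : ℝ) : ‖D t‖ ≤ 1 :=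
  (D t).opNorm_le_bound zero_le_one fun x => by rw [hD.norm_map, one_mul]

theorem IsUnitaryGroupOf.continuous_apply (hD : IsUnitaryGroupOf H₀ D) {f : ℝ → 𝓗}
    (hf : Continuous f) : Continuous fun t => D t (f t) :=
  continuous_clm_apply_of_bounded hD.opNorm_le_one hD.continuous hf

-- `D t (f t) - t • v` splits as `D t (f t - t • v) + t • (D t v - v)`.
theorem IsUnitaryGroupOf.hasDerivAt_apply_zero (hD : IsUnitaryGroupOf H₀ D) {f : ℝ → 𝓗} {v : 𝓗}
    (hf : HasDerivAt f v 0) (hf0 : f 0 = 0) : HasDerivAt (fun t => D t (f t)) v 0 := by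
  simp only [hasDerivAt_iff_isLittleO_nhds_zero, zero_add, hf0, _root_.map_zero, sub_zero] at hf ⊢
  have hfst : (fun t => D t (f t - t • v)) =o[nhds 0] fun t : ℝ => t :=
    .of_norm_left (by simpa only [hD.norm_map] using hf.norm_left)
  have hsnd : (fun t : ℝ => t • (D t v - v)) =o[nhds 0] fun t : ℝ => t := by
    have hlim : Tendsto (fun t => D t v - v) (nhds 0) (nhds 0) := by
      simpa [hD.map_zero] using ((hD.continuous v).tendsto 0).sub_const v
    simpa using (Asymptotics.isBigO_refl (fun t : ℝ => t) (nhds 0)).smul_isLittleO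
      ((Asymptotics.isLittleO_one_iff ℝ).2 hlim)
  refine (hfst.add hsnd).congr_left fun t => ?_
  rw [map_sub, smul_sub, show D t (t • v) = t • D t v from
    ((D t).restrictScalars ℝ).map_smul t v]
  abel

/-- The generator `-iB` in the interaction picture of the unitary group `D`. -/
def interaction (D : ℝ → 𝓗 →L[ℂ] 𝓗) (B : 𝓗 →L[ℂ] 𝓗) (t : ℝ) : 𝓗 →L[ℂ] 𝓗 :=
  -(Complex.I • (D (-t) ∘L B ∘L D t))

theorem interaction_apply (t : ℝ) (x : 𝓗) :
    interaction D B t x = -(Complex.I • D (-t) (B (D t x))) := rfl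

theorem IsUnitaryGroupOf.norm_interaction_le (hD : IsUnitaryGroupOf H₀ D) (t : ℝ) :
    ‖interaction D B t‖ ≤ ‖B‖ := by
  refine (interaction D B t).opNorm_le_bound (norm_nonneg _) fun x => ?_
  rw [interaction_apply, norm_neg, norm_smul, Complex.norm_I, one_mul, hD.norm_map,
    ← hD.norm_map t x]
  exact B.le_opNorm _

theorem IsUnitaryGroupOf.continuous_interaction (hD : IsUnitaryGroupOf H₀ D) (x : 𝓗) :
    Continuous fun t => interaction D B t x := by
  have h : Continuous fun t => D t (B (D (-t) x)) :=
    hD.continuous_apply (B.continuous.comp ((hD.continuous x).comp continuous_neg))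
  simpa only [interaction_apply, Function.comp_def, neg_neg] using
    continuous_neg.comp ((continuous_const_smul Complex.I).comp (h.comp continuous_neg))

theorem IsUnitaryGroupOf.interaction_add_apply (hD : IsUnitaryGroupOf H₀ D) (s t : ℝ) (x : 𝓗) :
    D s (interaction D B (t + s) x) = interaction D B t (D s x) := by
  simp [interaction_apply, hD.apply_apply]

variable [CompleteSpace 𝓗]

theorem IsUnitaryGroupOf.inner_interaction_eq_zero (hD : IsUnitaryGroupOf H₀ D)
    (hB : IsSelfAdjoint B) (t : ℝ) (x : 𝓗) : (inner ℂ x (interaction D B t x)).re = 0 := by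
  have hreal : (inner ℂ (D t x) (B (D t x))).im = 0 := hB.isSymmetric.im_inner_self_apply _
  rw [interaction_apply, inner_neg_right, inner_smul_right, ← hD.inner_map_map t,
    hD.apply_neg_apply]
  simp [hreal]

theorem IsUnitaryGroupOf.norm_dysonSeries_interaction (hD : IsUnitaryGroupOf H₀ D)
    (hB : IsSelfAdjoint B) (x : 𝓗) (t : ℝ) : ‖dysonSeries (interaction D B) x t‖ = ‖x‖ := by
  let _ : InnerProductSpace ℝ 𝓗 := InnerProductSpace.complexToReal
  rw [norm_eq_of_hasDerivAt_of_inner_eq_zero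
    (hasDerivAt_dysonSeries hD.norm_interaction_le hD.continuous_interaction x)
    (fun s => hD.inner_interaction_eq_zero hB s _) t 0, dysonSeries_zero hD.norm_interaction_le]

theorem IsUnitaryGroupOf.dysonSeries_interaction_add (hD : IsUnitaryGroupOf H₀ D) (s t : ℝ)
    (x : 𝓗) : D s (dysonSeries (interaction D B) x (t + s)) =
      dysonSeries (interaction D B) (D s (dysonSeries (interaction D B) x s)) t := by
  have hderiv : ∀ t, HasDerivAt (fun t => D s (dysonSeries (interaction D B) x (t + s)))
      (interaction D B t (D s (dysonSeries (interaction D B) x (t + s)))) t := fun t => by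
    rw [← hD.interaction_add_apply]
    exact ((D s).restrictScalars ℝ).hasFDerivAt.comp_hasDerivAt t
      ((hasDerivAt_dysonSeries hD.norm_interaction_le hD.continuous_interaction x
        (t + s)).comp_add_const t s)
  have h := eq_dysonSeries hD.norm_interaction_le hD.continuous_interaction hderiv
  rw [zero_add] at h
  exact congrFun h t

/-- The group `exp(-it(H₀ + B))`, obtained from `D t = exp(-itH₀)` and a bounded self-adjoint `B`
by solving the evolution equation in the interaction picture. -/
def IsUnitaryGroupOf.perturbed (hD : IsUnitaryGroupOf H₀ D) (hB : IsSelfAdjoint B) (t : ℝ) :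
    𝓗 →L[ℂ] 𝓗 :=
  D t ∘L LinearMap.mkContinuous
    { toFun := fun x => dysonSeries (interaction D B) x t
      map_add' := fun x y => congrFun
        (dysonSeries_add hD.norm_interaction_le hD.continuous_interaction x y) t
      map_smul' := fun c x => congrFun
        (dysonSeries_smul hD.norm_interaction_le hD.continuous_interaction c x) t }
    1 fun x => by simp [hD.norm_dysonSeries_interaction hB]

theorem IsUnitaryGroupOf.perturbed_apply (hD : IsUnitaryGroupOf H₀ D) (hB : IsSelfAdjoint B)
    (t : ℝ) (x : 𝓗) :
    hD.perturbed hB t x = D t (dysonSeries (interaction D B) x t) := rfl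

theorem IsUnitaryGroupOf.hasDerivAt_perturbed_sub (hD : IsUnitaryGroupOf H₀ D)
    (hB : IsSelfAdjoint B) (ψ : 𝓗) :
    HasDerivAt (fun t => hD.perturbed hB t ψ - D t ψ) (-(Complex.I • B ψ)) 0 := by
  have hzero : dysonSeries (interaction D B) ψ 0 = ψ := dysonSeries_zero hD.norm_interaction_le ψ
  have hderiv : HasDerivAt (dysonSeries (interaction D B) ψ) (-(Complex.I • B ψ)) 0 := by
    have h := hasDerivAt_dysonSeries hD.norm_interaction_le
      (hD.continuous_interaction (B := B)) ψ 0
    simpa [interaction_apply, hzero, hD.map_zero] using h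
  simpa only [perturbed_apply, map_sub] using
    hD.hasDerivAt_apply_zero (hderiv.sub_const ψ) (by rw [hzero, sub_self])

theorem IsUnitaryGroupOf.isUnitaryGroupOf_perturbed (hD : IsUnitaryGroupOf H₀ D)
    (hB : IsSelfAdjoint B) (hH : ∀ ψ φ, (ψ, φ) ∈ H.graph ↔ (ψ, φ - B ψ) ∈ H₀.graph) :
    IsUnitaryGroupOf H (hD.perturbed hB) where
  map_zero := by
    ext x
    simp [hD.perturbed_apply, hD.map_zero, dysonSeries_zero hD.norm_interaction_le]
  map_add s t := by
    ext x
    simp only [ContinuousLinearMap.comp_apply, hD.perturbed_apply,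
      ← hD.dysonSeries_interaction_add, hD.apply_apply]
  norm_map t x := by
    rw [hD.perturbed_apply, hD.norm_map, hD.norm_dysonSeries_interaction hB]
  continuous x := hD.continuous_apply <| continuous_iff_continuousAt.2 fun t =>
    (hasDerivAt_dysonSeries hD.norm_interaction_le hD.continuous_interaction x t).continuousAt
  generator ψ φ := by
    have hderiv := hD.hasDerivAt_perturbed_sub hB ψ
    rw [hH, hD.generator]
    constructor
    · intro h
      refine (h.add hderiv).congr_deriv ?_ |>.congr_of_eventuallyEq (.of_forall fun t => ?_)
      · rw [smul_sub]; abel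
      · simp
    · intro h
      refine (h.sub hderiv).congr_deriv ?_ |>.congr_of_eventuallyEq (.of_forall fun t => ?_)
      · rw [smul_sub]; abel
      · simp

end Perturbation

section Multiplication

variable {ι : Type}

theorem mem_graph_ellTwoOperator {τ : (ι → ℂ) →ₗ[ℂ] (ι → ℂ)} {ψ φ : EllTwo ι} :
    (ψ, φ) ∈ (ellTwoOperator τ).graph ↔ (φ : ι → ℂ) = τ ψ := by
  rw [LinearPMap.mem_graph_iff]
  constructor
  · rintro ⟨ψ', rfl, rfl⟩
    rfl
  · intro h
    exact ⟨⟨ψ, show Memℓp (τ ψ) 2 from h ▸ lp.memℓp φ⟩, rfl, lp.ext h.symm⟩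

theorem norm_sq_ellTwo (f : EllTwo ι) : ‖f‖ ^ 2 = ∑' n, ‖f n‖ ^ 2 := by
  simpa using lp.norm_rpow_eq_tsum (p := 2) (by norm_num) f

theorem summable_norm_sq_ellTwo (f : EllTwo ι) : Summable fun n => ‖f n‖ ^ 2 := by
  simpa using (lp.memℓp f).summable (by norm_num)

theorem tendsto_ellTwo_of_dominated {α : Type*} {l : Filter α} {F : α → EllTwo ι}
    {f : EllTwo ι} {g : ι → ℝ} (hg : Summable fun n => g n ^ 2)
    (hbound : ∀ᶠ a in l, ∀ n, ‖F a n - f n‖ ≤ g n)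
    (hlim : ∀ n, Tendsto (fun a => F a n) l (nhds (f n))) : Tendsto F l (nhds f) := by
  have hsq : Tendsto (fun a => ∑' n, ‖F a n - f n‖ ^ 2) l (nhds (∑' _, 0)) :=
    tendsto_tsum_of_dominated_convergence hg
      (fun n => by simpa using ((hlim n).sub_const (f n)).norm.pow 2)
      (hbound.mono fun a ha n => by
        rw [norm_pow, norm_norm]
        exact pow_le_pow_left₀ (norm_nonneg _) (ha n) 2)
  have hnorm : Tendsto (fun a => ‖F a - f‖ ^ 2) l (nhds 0) := by
    simpa only [norm_sq_ellTwo, lp.coeFn_sub, Pi.sub_apply, tsum_zero] using hsq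
  rw [tendsto_iff_norm_sub_tendsto_zero]
  simpa [Function.comp_def, Real.sqrt_sq] using (Real.continuous_sqrt.tendsto 0).comp hnorm

theorem summable_sq_two_mul_norm (f : EllTwo ι) : Summable fun n => (2 * ‖f n‖) ^ 2 := by
  simpa only [mul_pow] using (summable_norm_sq_ellTwo f).mul_left _

/-- Multiplication by a real function, as a formal operator. -/
def mulExpr (V : ι → ℝ) : (ι → ℂ) →ₗ[ℂ] (ι → ℂ) where
  toFun u n := (V n : ℂ) * u n
  map_add' _ _ := funext fun _ => mul_add _ _ _
  map_smul' _ _ := funext fun _ => mul_left_comm _ _ _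

theorem norm_phase (x : ℝ) : ‖Complex.exp (Complex.I * x)‖ = 1 := by
  rw [mul_comm, Complex.norm_exp_ofReal_mul_I]

/-- The unitary group `exp(-itV)` generated by multiplication by `V`. -/
def phaseGroup (V : ι → ℝ) (t : ℝ) : EllTwo ι →L[ℂ] EllTwo ι :=
  LinearMap.mkContinuous
    { toFun := fun f => ⟨fun n => Complex.exp (Complex.I * (-t * V n : ℝ)) * f n,
        (lp.memℓp f).mono' fun n => by rw [norm_mul, norm_phase, one_mul]⟩
      map_add' := fun f g => lp.ext <| funext fun n => mul_add _ (f n) (g n)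
      map_smul' := fun c f => lp.ext <| funext fun n => mul_left_comm _ c (f n) } 1
    fun f => by
      rw [one_mul]
      exact lp.norm_mono two_ne_zero fun n => by
        rw [LinearMap.coe_mk, AddHom.coe_mk, norm_mul, norm_phase, one_mul]

variable (V : ι → ℝ)

theorem phaseGroup_apply (t : ℝ) (f : EllTwo ι) (n : ι) :
    phaseGroup V t f n = Complex.exp (Complex.I * (-t * V n : ℝ)) * f n := rfl

theorem norm_phaseGroup_apply (t : ℝ) (f : EllTwo ι) (n : ι) :
    ‖phaseGroup V t f n‖ = ‖f n‖ := by
  rw [phaseGroup_apply, norm_mul, norm_phase, one_mul]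

theorem phaseGroup_zero (f : EllTwo ι) : phaseGroup V 0 f = f := by
  ext n
  simp [phaseGroup_apply]

theorem continuous_phaseGroup (f : EllTwo ι) : Continuous fun t => phaseGroup V t f := by
  refine continuous_iff_continuousAt.2 fun t =>
    tendsto_ellTwo_of_dominated (summable_sq_two_mul_norm f) (.of_forall fun s n => ?_) fun n => ?_
  · calc ‖phaseGroup V s f n - phaseGroup V t f n‖
        ≤ ‖phaseGroup V s f n‖ + ‖phaseGroup V t f n‖ := norm_sub_le _ _
      _ = 2 * ‖f n‖ := by rw [norm_phaseGroup_apply, norm_phaseGroup_apply, two_mul]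
  · simp only [phaseGroup_apply]
    exact Continuous.tendsto (by fun_prop) t

theorem hasDerivAt_phaseGroup_apply_zero (ψ : EllTwo ι) (n : ι) :
    HasDerivAt (fun t => phaseGroup V t ψ n) (-(Complex.I * (V n * ψ n))) 0 := by
  have hphase : HasDerivAt (fun t : ℝ => Complex.I * (-t * V n : ℝ))
      (Complex.I * (-1 * V n : ℝ)) 0 :=
    (((hasDerivAt_id' (0 : ℝ)).neg.mul_const (V n)).ofReal_comp).const_mul Complex.I
  refine (hphase.cexp.mul_const (ψ n)).congr_deriv ?_
  simp [mul_assoc]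

theorem norm_slope_phaseGroup_apply_le (ψ : EllTwo ι) (t : ℝ) (n : ι) :
    ‖slope (fun t => phaseGroup V t ψ) 0 t n‖ ≤ ‖(V n : ℂ) * ψ n‖ := by
  have hslope : slope (fun t => phaseGroup V t ψ) 0 t n =
      (t⁻¹ : ℝ) * ((Complex.exp (Complex.I * (-t * V n : ℝ)) - 1) * ψ n) := by
    rw [slope, phaseGroup_zero, sub_mul, one_mul, sub_zero]
    rfl
  calc ‖slope (fun t => phaseGroup V t ψ) 0 t n‖
      ≤ |t|⁻¹ * (‖-t * V n‖ * ‖ψ n‖) := by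
        rw [hslope, norm_mul, norm_mul, Complex.norm_real, norm_inv, Real.norm_eq_abs]
        gcongr
        exact Real.norm_exp_I_mul_ofReal_sub_one_le
    _ = |t|⁻¹ * |t| * ‖(V n : ℂ) * ψ n‖ := by
        rw [norm_mul, norm_neg, norm_mul, Complex.norm_real, Real.norm_eq_abs t]
        ring
    _ ≤ ‖(V n : ℂ) * ψ n‖ := mul_le_of_le_one_left (norm_nonneg _) inv_mul_le_one

theorem hasDerivAt_phaseGroup_iff (ψ φ : EllTwo ι) :
    HasDerivAt (fun t => phaseGroup V t ψ) (-(Complex.I • φ)) 0 ↔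
      (φ : ι → ℂ) = mulExpr V ψ := by
  constructor
  · intro h
    funext n
    have hcoord : HasDerivAt (fun t => phaseGroup V t ψ n) (-(Complex.I * φ n)) 0 :=
      ((lp.evalCLM ℂ (fun _ : ι => ℂ) 2 n).restrictScalars ℝ).hasFDerivAt.comp_hasDerivAt 0 h
    exact mul_left_cancel₀ Complex.I_ne_zero
      (neg_injective (hcoord.unique (hasDerivAt_phaseGroup_apply_zero V ψ n)))
  · intro h
    have hφ : ∀ n, φ n = V n * ψ n := congrFun h
    refine hasDerivAt_iff_tendsto_slope.2 <| tendsto_ellTwo_of_dominated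
      (summable_sq_two_mul_norm φ) (.of_forall fun t n => ?_) fun n => ?_
    · calc ‖slope (fun t => phaseGroup V t ψ) 0 t n - (-(Complex.I • φ) : EllTwo ι) n‖
          ≤ ‖slope (fun t => phaseGroup V t ψ) 0 t n‖ + ‖(-(Complex.I • φ) : EllTwo ι) n‖ :=
            norm_sub_le _ _
        _ ≤ ‖φ n‖ + ‖φ n‖ := by
            refine add_le_add (hφ n ▸ norm_slope_phaseGroup_apply_le V ψ t n) (le_of_eq ?_)
            rw [lp.coeFn_neg, Pi.neg_apply, norm_neg, lp.coeFn_smul, Pi.smul_apply, norm_smul,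
              Complex.norm_I, one_mul]
        _ = 2 * ‖φ n‖ := (two_mul _).symm
    · have hlim := hasDerivAt_iff_tendsto_slope.1 (hasDerivAt_phaseGroup_apply_zero V ψ n)
      rw [← hφ] at hlim
      exact hlim

theorem isUnitaryGroupOf_phaseGroup :
    IsUnitaryGroupOf (ellTwoOperator (mulExpr V)) (phaseGroup V) where
  map_zero := by
    ext f n
    simp [phaseGroup_zero]
  map_add s t := by
    ext f n
    simp only [ContinuousLinearMap.comp_apply, phaseGroup_apply]
    rw [← mul_assoc, ← Complex.exp_add]
    congr 2
    push_cast
    ring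
  norm_map t f := by
    simp [← sq_eq_sq₀ (norm_nonneg _), norm_sq_ellTwo, norm_phaseGroup_apply]
  continuous := continuous_phaseGroup V
  generator ψ φ := mem_graph_ellTwoOperator.trans (hasDerivAt_phaseGroup_iff V ψ φ).symm

end Multiplication

section Existence

variable {ι κ : Type}

/-- The pullback `f ↦ f ∘ e` of square summable families along an injective map `e`. -/
def pullback (e : ι → κ) (he : Function.Injective e) : EllTwo κ →L[ℂ] EllTwo ι :=
  LinearMap.mkContinuous
    { toFun := fun f => ⟨fun n => f (e n), memℓp_gen <| by
        simpa [Function.comp_def] using (summable_norm_sq_ellTwo f).comp_injective he⟩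
      map_add' := fun _ _ => rfl
      map_smul' := fun _ _ => rfl } 1
    fun f => by
      rw [one_mul, ← sq_le_sq₀ (norm_nonneg _) (norm_nonneg _), norm_sq_ellTwo, norm_sq_ellTwo]
      exact tsum_comp_le_tsum_of_inj (summable_norm_sq_ellTwo f) (fun n => by positivity) he

theorem pullback_apply {e : ι → κ} (he : Function.Injective e) (f : EllTwo κ) (n : ι) :
    pullback e he f n = f (e n) := rfl

open Classical in
theorem coe_adjoint_pullback {e : ι → κ} (he : Function.Injective e) (f : EllTwo ι) :
    ((pullback e he).adjoint f : κ → ℂ) = Function.extend e f 0 := by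
  funext k
  have hk : inner ℂ (pullback e he (lp.single 2 k (1 : ℂ))) f = (pullback e he).adjoint f k := by
    rw [← ContinuousLinearMap.adjoint_inner_right, lp.inner_single_left]
    simp
  rw [← hk]
  by_cases h : ∃ n, e n = k
  · obtain ⟨n, rfl⟩ := h
    have hsingle : pullback e he (lp.single 2 (e n) (1 : ℂ)) = lp.single 2 n (1 : ℂ) := by
      ext m
      simp [pullback_apply, lp.single_apply, Pi.single_apply, he.eq_iff]
    rw [hsingle, lp.inner_single_left, he.extend_apply]
    simp
  · have hsingle : pullback e he (lp.single 2 k (1 : ℂ)) = 0 := by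
      ext m
      rw [pullback_apply, lp.single_apply_ne _ _ _ fun hm => h ⟨m, hm⟩]
      rfl
    rw [hsingle, inner_zero_left, Function.extend_apply' _ _ _ h, Pi.zero_apply]

/-- The formal operator `τ` on sequences indexed by `ι` is the restriction to the sites
`pos n`, `n : ι`, of the line operator with potential `V`, with Dirichlet conditions elsewhere. -/
def IsDirichletRestriction (pos : ι → ℤ) (V : ℤ → ℝ) (τ : (ι → ℂ) →ₗ[ℂ] (ι → ℂ)) : Prop :=
  ∀ f n, τ f n = lineExpr V (Function.extend pos f 0) (pos n)

/-- The bounded operator `(Bf)(n) = f(n-1) + f(n+1)` on sequences on the sites `pos n`, extended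
by zero to the other sites. -/
def hopping (pos : ι → ℤ) (hpos : Function.Injective pos) : EllTwo ι →L[ℂ] EllTwo ι :=
  let S := pullback (fun n : ℤ => n + 1) (add_left_injective 1)
  pullback pos hpos ∘L (S + S.adjoint) ∘L (pullback pos hpos).adjoint

variable {pos : ι → ℤ} (hpos : Function.Injective pos)

theorem hopping_apply (f : EllTwo ι) (n : ι) :
    hopping pos hpos f n =
      Function.extend pos f 0 (pos n - 1) + Function.extend pos f 0 (pos n + 1) := by
  have hS : Function.extend (fun n : ℤ => n + 1) (Function.extend pos f 0) 0 (pos n) =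
      Function.extend pos f 0 (pos n - 1) := by
    have := (add_left_injective (1 : ℤ)).extend_apply (Function.extend pos f 0) 0 (pos n - 1)
    rwa [sub_add_cancel] at this
  simp [hopping, pullback_apply, coe_adjoint_pullback, hS, add_comm]

theorem isSelfAdjoint_hopping : IsSelfAdjoint (hopping pos hpos) :=
  (IsSelfAdjoint.add_star_self _).conj_adjoint _

variable {V : ℤ → ℝ} {τ : (ι → ℂ) →ₗ[ℂ] (ι → ℂ)} (hτ : IsDirichletRestriction pos V τ)
include hτ hpos

theorem IsDirichletRestriction.apply_eq_hopping_add (f : EllTwo ι) (n : ι) :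
    τ f n = hopping pos hpos f n + V (pos n) * f n := by
  rw [hτ, hopping_apply, lineExpr, LinearMap.coe_mk, AddHom.coe_mk, hpos.extend_apply]

theorem IsDirichletRestriction.exists_isUnitaryGroupOf :
    ∃ U, IsUnitaryGroupOf (ellTwoOperator τ) U := by
  refine ⟨_, (isUnitaryGroupOf_phaseGroup fun n => V (pos n)).isUnitaryGroupOf_perturbed
    (isSelfAdjoint_hopping hpos) fun ψ φ => ?_⟩
  have h : τ ψ = (hopping pos hpos ψ : ι → ℂ) + mulExpr (fun n => V (pos n)) ψ :=
    funext (hτ.apply_eq_hopping_add hpos ψ)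
  rw [mem_graph_ellTwoOperator, mem_graph_ellTwoOperator, h, lp.coeFn_sub, sub_eq_iff_eq_add']

theorem IsDirichletRestriction.single_mem_domain [DecidableEq ι] (o : ι) :
    (lp.single 2 o (1 : ℂ) : EllTwo ι) ∈ (ellTwoOperator τ).domain := by
  set δ : EllTwo ι := lp.single 2 o (1 : ℂ) with hδ
  have h : τ δ = (hopping pos hpos δ + (V (pos o) : ℂ) • δ : EllTwo ι) := by
    funext n
    rw [hτ.apply_eq_hopping_add hpos, lp.coeFn_add, Pi.add_apply, lp.coeFn_smul, Pi.smul_apply,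
      smul_eq_mul]
    rcases eq_or_ne n o with rfl | hn
    · rfl
    · simp [hδ, hn]
  exact show Memℓp (τ δ) 2 from h ▸ lp.memℓp _

end Existence

section Plancherel

open scoped FourierTransform SchwartzMap

variable {E F : Type*} [NormedAddCommGroup E] [InnerProductSpace ℝ E] [FiniteDimensional ℝ E]
  [MeasurableSpace E] [BorelSpace E] [NormedAddCommGroup F] [InnerProductSpace ℂ F]
  {f : E → F}

theorem continuous_fourier (hint : Integrable f) : Continuous (𝓕 f) :=
  VectorFourier.fourierIntegral_continuous Real.continuous_fourierChar continuous_inner hint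

variable [CompleteSpace F]

-- Both sides define the same tempered distribution.
theorem fourier_toLp_ae_eq (hint : Integrable f) (hsq : MemLp f 2) :
    (𝓕 (hsq.toLp f) : Lp F 2 (volume : Measure E)) =ᵐ[volume] 𝓕 f := by
  refine ae_eq_of_integral_contDiff_smul_eq ((Lp.memLp _).locallyIntegrable (by norm_num))
    (continuous_fourier hint).locallyIntegrable fun g hg hgc => ?_
  set G : 𝓢(E, ℂ) :=
    (hgc.comp_left rfl : HasCompactSupport (Complex.ofRealCLM ∘ g)).toSchwartzMap (by fun_prop)
  have hG : ∀ x, G x = (g x : ℂ) := fun _ => rfl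
  calc ∫ x, g x • (𝓕 (hsq.toLp f) : Lp F 2 (volume : Measure E)) x
      = ((𝓕 (hsq.toLp f) : Lp F 2 (volume : Measure E)) : 𝓢'(E, F)) G := by
        simp [Lp.toTemperedDistribution_apply, hG]
    _ = ∫ x, (𝓕 G) x • (hsq.toLp f) x := by
        rw [← Lp.fourier_toTemperedDistribution_eq, TemperedDistribution.fourier_apply,
          Lp.toTemperedDistribution_apply]
    _ = ∫ x, (𝓕 G) x • f x := by
        refine integral_congr_ae ?_
        filter_upwards [hsq.coeFn_toLp] with x hx
        rw [hx]
    _ = ∫ x, G x • 𝓕 f x := by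
        have h := VectorFourier.integral_fourierIntegral_smul_eq_flip (L := innerₗ E)
          (μ := volume) (ν := volume) Real.continuous_fourierChar continuous_inner G.integrable hint
        rwa [flip_innerₗ] at h
    _ = ∫ x, g x • 𝓕 f x := by simp [hG]

theorem eLpNorm_fourier_two (hint : Integrable f) (hsq : MemLp f 2) :
    eLpNorm (𝓕 f) 2 = eLpNorm f 2 := by
  rw [← eLpNorm_congr_ae (fourier_toLp_ae_eq hint hsq), ← eLpNorm_congr_ae hsq.coeFn_toLp]
  refine (ENNReal.toReal_eq_toReal_iff' (Lp.eLpNorm_ne_top _) (Lp.eLpNorm_ne_top _)).1 ?_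
  simpa only [Lp.norm_def] using Lp.norm_fourier_eq (hsq.toLp f)

theorem lintegral_enorm_sq_fourier (hint : Integrable f) (hsq : MemLp f 2) :
    ∫⁻ ξ, ‖𝓕 f ξ‖ₑ ^ 2 = ∫⁻ t, ‖f t‖ₑ ^ 2 := by
  have key (g : E → F) : ∫⁻ x, ‖g x‖ₑ ^ 2 = eLpNorm g 2 ^ 2 := by
    simpa using (eLpNorm_nnreal_pow_eq_lintegral (f := g) (μ := volume) (p := 2) two_ne_zero).symm
  rw [key, key, eLpNorm_fourier_two hint hsq]

end Plancherel

section Laplace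

open scoped FourierTransform

theorem lintegral_eq_mul_lintegral_comp_mul_left {a : ℝ} (ha : a ≠ 0) (f : ℝ → ℝ≥0∞) :
    ∫⁻ x, f x = ENNReal.ofReal |a| * ∫⁻ x, f (a * x) := by
  conv_lhs => rw [← Real.smul_map_volume_mul_left ha]
  rw [lintegral_smul_measure, (measurableEmbedding_mulLeft₀ ha).lintegral_map, smul_eq_mul]

/-- The Laplace transform `∫₀^∞ exp(izt) a(t) dt`, a function on the upper half plane. -/
def laplace (a : ℝ → ℂ) (z : ℂ) : ℂ :=
  ∫ t in Set.Ioi (0 : ℝ), Complex.exp (Complex.I * z * t) * a t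

variable {a c f : ℝ → ℂ} {b : ℝ} {z : ℂ}

theorem norm_exp_I_mul (z : ℂ) (t : ℝ) :
    ‖Complex.exp (Complex.I * z * t)‖ = Real.exp (-(z.im * t)) := by
  simp [Complex.norm_exp]

theorem integrableOn_exp_mul (ha : Continuous a) (hb : ∀ t, ‖a t‖ ≤ b) (hz : 0 < z.im) :
    IntegrableOn (fun t : ℝ => Complex.exp (Complex.I * z * t) * a t) (Set.Ioi 0) := by
  have hexp : IntegrableOn (fun t : ℝ => Real.exp (-(z.im * t)) * b) (Set.Ioi 0) := by
    simpa only [IntegrableOn, neg_mul] using (exp_neg_integrableOn_Ioi 0 hz).mul_const b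
  refine hexp.mono' (by fun_prop) (ae_of_all _ fun t => ?_)
  rw [norm_mul, norm_exp_I_mul]
  gcongr
  exact hb t

theorem laplace_add (ha : Continuous a) (hb : ∀ t, ‖a t‖ ≤ b) (hc : Continuous c) {b' : ℝ}
    (hbc : ∀ t, ‖c t‖ ≤ b') (hz : 0 < z.im) :
    laplace (fun t => a t + c t) z = laplace a z + laplace c z := by
  simp only [laplace, mul_add]
  exact integral_add (integrableOn_exp_mul ha hb hz) (integrableOn_exp_mul hc hbc hz)

theorem laplace_const_mul (v : ℂ) : laplace (fun t => v * a t) z = v * laplace a z := by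
  simp only [laplace, mul_left_comm _ v, integral_const_mul]

theorem laplace_eq_of_hasDerivAt (hc : Continuous c) (hbc : ∀ t, ‖c t‖ ≤ b) (hf : Continuous f)
    {b' : ℝ} (hbf : ∀ t, ‖f t‖ ≤ b') (hd : ∀ t, HasDerivAt c (-(Complex.I * f t)) t)
    (hz : 0 < z.im) : laplace f z = z * laplace c z - Complex.I * c 0 := by
  set e : ℝ → ℂ := fun t => Complex.exp (Complex.I * z * t) with he
  have hint_c := (integrableOn_exp_mul hc hbc hz).const_mul (Complex.I * z)
  have hint_f := (integrableOn_exp_mul hf hbf hz).const_mul Complex.I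
  have hderiv : ∀ t, HasDerivAt (fun t => e t * c t)
      (Complex.I * z * (e t * c t) - Complex.I * (e t * f t)) t := fun t => by
    have hlin : HasDerivAt (fun t : ℝ => Complex.I * z * (t : ℂ)) (Complex.I * z) t := by
      simpa using (hasDerivAt_id' t).ofReal_comp.const_mul (Complex.I * z)
    refine (hlin.cexp.mul (hd t)).congr_deriv ?_
    ring
  have hlim : Tendsto (fun t => e t * c t) atTop (nhds 0) := by
    have hexp : Tendsto (fun t : ℝ => Real.exp (-(z.im * t)) * b) atTop (nhds 0) := by
      simpa using (Real.tendsto_exp_neg_atTop_nhds_zero.comp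
        (tendsto_id.const_mul_atTop hz)).mul_const b
    refine squeeze_zero_norm (fun t => ?_) hexp
    rw [norm_mul, norm_exp_I_mul]
    gcongr
    exact hbc t
  have hparts := integral_Ioi_of_hasDerivAt_of_tendsto (a := 0)
    (hderiv 0).continuousAt.continuousWithinAt (fun t _ => hderiv t) (hint_c.sub hint_f) hlim
  rw [integral_sub hint_c hint_f, integral_const_mul, integral_const_mul,
    show e 0 = 1 by simp [he], one_mul, zero_sub] at hparts
  change Complex.I * z * laplace c z - Complex.I * laplace f z = -c 0 at hparts
  linear_combination Complex.I * hparts + (laplace f z - z * laplace c z) * Complex.I_sq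

/-- The signal `1_{t > 0} exp(-ηt) a(t)`, whose Fourier transform is the Laplace transform of `a`
on the line `im z = η`. -/
def damped (a : ℝ → ℂ) (η : ℝ) : ℝ → ℂ :=
  Set.indicator (Set.Ioi 0) fun t => Complex.exp (Complex.I * (Complex.I * η) * t) * a t

theorem integrable_damped (ha : Continuous a) (hb : ∀ t, ‖a t‖ ≤ b) {η : ℝ} (hη : 0 < η) :
    Integrable (damped a η) :=
  (integrable_indicator_iff measurableSet_Ioi).2 (integrableOn_exp_mul ha hb (by simpa using hη))

theorem norm_damped (a : ℝ → ℂ) (η t : ℝ) :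
    ‖damped a η t‖ = Set.indicator (Set.Ioi 0) (fun t => Real.exp (-(η * t)) * ‖a t‖) t := by
  rw [damped, norm_indicator_eq_indicator_norm]
  simp [norm_exp_I_mul]

theorem memLp_damped (ha : Continuous a) (hb : ∀ t, ‖a t‖ ≤ b) {η : ℝ} (hη : 0 < η) :
    MemLp (damped a η) 2 := by
  have hint := integrable_damped ha hb hη
  rw [memLp_two_iff_integrable_sq_norm hint.aestronglyMeasurable]
  refine (hint.norm.const_mul b).mono' (by fun_prop) (ae_of_all _ fun t => ?_)
  have hle : ‖damped a η t‖ ≤ b := by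
    rw [norm_damped]
    refine Set.indicator_apply_le' (fun ht => ?_) fun _ => (norm_nonneg _).trans (hb 0)
    refine (mul_le_of_le_one_left (norm_nonneg _) (Real.exp_le_one_iff.2 ?_)).trans (hb t)
    exact neg_nonpos.2 (mul_nonneg hη.le (Set.mem_Ioi.1 ht).le)
  rw [Real.norm_of_nonneg (by positivity), sq]
  gcongr

theorem fourier_damped (a : ℝ → ℂ) (η ξ : ℝ) :
    𝓕 (damped a η) ξ = laplace a ((-(2 * Real.pi) * ξ : ℝ) + Complex.I * η) := by
  rw [Real.fourier_eq', laplace, ← integral_indicator measurableSet_Ioi]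
  refine integral_congr_ae (ae_of_all _ fun t => ?_)
  simp only [damped, Set.indicator_apply, smul_eq_mul, mul_ite, mul_zero]
  refine if_congr Iff.rfl ?_ rfl
  rw [← mul_assoc, ← Complex.exp_add]
  congr 2
  simp
  ring

theorem continuous_laplace (ha : Continuous a) (hb : ∀ t, ‖a t‖ ≤ b) {η : ℝ} (hη : 0 < η) :
    Continuous fun E : ℝ => laplace a (E + Complex.I * η) := by
  have h := (continuous_fourier (integrable_damped ha hb hη)).comp
    (continuous_const_mul (-(2 * Real.pi))⁻¹)
  simpa only [Function.comp_def, fourier_damped,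
    mul_inv_cancel_left₀ (neg_ne_zero.2 Real.two_pi_pos.ne')] using h

theorem lintegral_sq_norm_laplace (ha : Continuous a) (hb : ∀ t, ‖a t‖ ≤ b) {η : ℝ} (hη : 0 < η) :
    ∫⁻ E : ℝ, ENNReal.ofReal (‖laplace a (E + Complex.I * η)‖ ^ 2) = ENNReal.ofReal (2 * Real.pi) *
      ∫⁻ t in Set.Ioi (0 : ℝ), ENNReal.ofReal ((Real.exp (-(η * t)) * ‖a t‖) ^ 2) := by
  have hpi : -(2 * Real.pi) ≠ 0 := by simp [Real.pi_ne_zero]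
  rw [lintegral_eq_mul_lintegral_comp_mul_left hpi, abs_neg, abs_of_pos Real.two_pi_pos,
    ← lintegral_indicator measurableSet_Ioi]
  have h := lintegral_enorm_sq_fourier (integrable_damped ha hb hη) (memLp_damped ha hb hη)
  simp only [fourier_damped, ← ofReal_norm, ← ENNReal.ofReal_pow (norm_nonneg _)] at h
  rw [h]
  congr 1
  refine lintegral_congr fun t => ?_
  rw [norm_damped]
  by_cases ht : t ∈ Set.Ioi (0 : ℝ) <;> simp [ht]

end Laplace

section Dynamics

variable {ι : Type} [DecidableEq ι] {o : ι} {pos : ι → ℤ}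

section

variable {H : EllTwo ι →ₗ.[ℂ] EllTwo ι}

/-- `exp(-itH) δ_o`, as a sequence on `ℤ` that vanishes off the sites `pos n`. -/
def evolution (H : EllTwo ι →ₗ.[ℂ] EllTwo ι) (o : ι) (pos : ι → ℤ) (t : ℝ) : ℤ → ℂ :=
  Function.extend pos (amplitude H o t) 0

/-- `-i(H - z)⁻¹ δ_o`, the Laplace transform of the evolution of `δ_o`, as a sequence on `ℤ` that
vanishes off the sites `pos n`. -/
def resolventState (H : EllTwo ι →ₗ.[ℂ] EllTwo ι) (o : ι) (pos : ι → ℤ) (z : ℂ) (k : ℤ) : ℂ :=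
  laplace (fun t => evolution H o pos t k) z

theorem evolution_apply (hpos : Function.Injective pos) (t : ℝ) (n : ι) :
    evolution H o pos t (pos n) = amplitude H o t n :=
  hpos.extend_apply _ _ _

theorem evolution_of_notMem_range {k : ℤ} (hk : k ∉ Set.range pos) (t : ℝ) :
    evolution H o pos t k = 0 :=
  Function.extend_apply' _ _ _ hk

theorem resolventState_of_notMem_range {k : ℤ} (hk : k ∉ Set.range pos) (z : ℂ) :
    resolventState H o pos z k = 0 := by
  simp [resolventState, evolution_of_notMem_range hk, laplace]

theorem norm_evolution_le (hU : ∃ U, IsUnitaryGroupOf H U) (hpos : Function.Injective pos) (k : ℤ)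
    (t : ℝ) : ‖evolution H o pos t k‖ ≤ 1 := by
  by_cases hk : k ∈ Set.range pos
  · obtain ⟨n, rfl⟩ := hk
    rw [evolution_apply hpos]
    refine (lp.norm_apply_le_norm two_ne_zero _ n).trans ?_
    rw [(unitaryGroup_spec hU).norm_map, lp.norm_single two_pos, norm_one]
  · simp [evolution_of_notMem_range hk]

theorem continuous_evolution (hU : ∃ U, IsUnitaryGroupOf H U) (hpos : Function.Injective pos)
    (k : ℤ) : Continuous fun t => evolution H o pos t k := by
  by_cases hk : k ∈ Set.range pos
  · obtain ⟨n, rfl⟩ := hk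
    simp only [evolution_apply hpos]
    exact (lp.evalCLM ℂ (fun _ : ι => ℂ) 2 n).continuous.comp
      ((unitaryGroup_spec hU).continuous _)
  · simp only [evolution_of_notMem_range hk, continuous_const]

theorem evolution_zero_apply (hU : ∃ U, IsUnitaryGroupOf H U) (hpos : Function.Injective pos)
    (n : ι) : evolution H o pos 0 (pos n) = if n = o then 1 else 0 := by
  rw [evolution_apply hpos, amplitude, (unitaryGroup_spec hU).map_zero]
  simp [lp.single_apply, Pi.single_apply]

theorem timeAverage_eq_lintegral (hU : ∃ U, IsUnitaryGroupOf H U)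
    (hpos : Function.Injective pos) (n : ι) {T : ℝ} (hT : 0 < T) :
    timeAverage H o n T = ENNReal.ofReal (1 / (2 * Real.pi * T)) * ∫⁻ E : ℝ,
      ENNReal.ofReal (‖resolventState H o pos (E + Complex.I * (1 / T : ℝ)) (pos n)‖ ^ 2) := by
  simp only [resolventState]
  rw [lintegral_sq_norm_laplace (continuous_evolution hU hpos _) (norm_evolution_le hU hpos _)
    (by positivity), ← mul_assoc, ← ENNReal.ofReal_mul (by positivity), timeAverage]
  congr 1
  · field_simp
  · refine lintegral_congr fun t => ?_
    rw [evolution_apply hpos, mul_pow, ← Real.exp_nat_mul]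
    congr 3
    push_cast
    ring

theorem le_moment (hU : ∃ U, IsUnitaryGroupOf H U) (hpos : Function.Injective pos) {p T K c : ℝ}
    (hT : 0 < T) (hp : 0 ≤ p) (hK : 0 ≤ K) {S : Finset ι} (hS : ∀ n ∈ S, K ≤ |(pos n : ℝ)|)
    {J : Set ℝ} (hJ : MeasurableSet J)
    (h : ∀ E ∈ J, c ≤
      ∑ n ∈ S, ‖resolventState H o pos (E + Complex.I * (1 / T : ℝ)) (pos n)‖ ^ 2) :
    ENNReal.ofReal (K ^ p) * (ENNReal.ofReal (1 / (2 * Real.pi * T)) *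
      (ENNReal.ofReal c * volume J)) ≤ moment H o pos p T := by
  set g : ι → ℝ → ℝ := fun n E =>
    ‖resolventState H o pos (E + Complex.I * (1 / T : ℝ)) (pos n)‖ ^ 2 with hg
  have hcont : ∀ n, Continuous (g n) := fun n =>
    (continuous_laplace (continuous_evolution hU hpos _) (norm_evolution_le hU hpos _)
      (by positivity)).norm.pow 2
  have hwindow : ENNReal.ofReal c * volume J ≤ ∑ n ∈ S, ∫⁻ E, ENNReal.ofReal (g n E) :=
    calc ENNReal.ofReal c * volume J = ∫⁻ _ in J, ENNReal.ofReal c := by simp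
      _ ≤ ∫⁻ E in J, ENNReal.ofReal (∑ n ∈ S, g n E) :=
        setLIntegral_mono' hJ fun E hE => ENNReal.ofReal_le_ofReal (h E hE)
      _ ≤ ∫⁻ E, ENNReal.ofReal (∑ n ∈ S, g n E) := setLIntegral_le_lintegral _ _
      _ = ∑ n ∈ S, ∫⁻ E, ENNReal.ofReal (g n E) := by
        simp only [fun E => ENNReal.ofReal_sum_of_nonneg (s := S) fun n _ => sq_nonneg
          ‖resolventState H o pos (E + Complex.I * (1 / T : ℝ)) (pos n)‖, hg]
        exact lintegral_finsetSum _ fun n _ => (hcont n).measurable.ennreal_ofReal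
  calc _ ≤ ENNReal.ofReal (K ^ p) * ∑ n ∈ S, timeAverage H o n T := by
        simp only [timeAverage_eq_lintegral hU hpos _ hT, ← Finset.mul_sum]
        gcongr
    _ ≤ ∑ n ∈ S, ENNReal.ofReal (|(pos n : ℝ)| ^ p) * timeAverage H o n T := by
        rw [Finset.mul_sum]
        gcongr with n hn
        exact hS n hn
    _ ≤ moment H o pos p T := ENNReal.sum_le_tsum S

theorem le_betaMinus {p q c : ℝ} (hc : 0 < c)
    (h : ∀ᶠ T in atTop, ENNReal.ofReal (c * T ^ q) ≤ moment H o pos p T) :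
    (q : EReal) ≤ betaMinus H o pos p := by
  have hlim : Tendsto (fun T : ℝ => ((Real.log c / Real.log T + q : ℝ) : EReal)) atTop
      (nhds (q : EReal)) := by
    refine (continuous_coe_real_ereal.tendsto q).comp ?_
    simpa using (Real.tendsto_log_atTop.const_div_atTop (Real.log c)).add_const q
  rw [← hlim.liminf_eq, betaMinus]
  refine liminf_le_liminf ?_
  filter_upwards [h, eventually_gt_atTop 1] with T hT hT1
  have hT0 : 0 < T := zero_lt_one.trans hT1
  have hlog : 0 < Real.log T := Real.log_pos hT1
  calc ((Real.log c / Real.log T + q : ℝ) : EReal)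
      = ((Real.log (c * T ^ q) : ℝ) : EReal) / ((Real.log T : ℝ) : EReal) := by
        rw [← EReal.coe_div, Real.log_mul hc.ne' (Real.rpow_pos_of_pos hT0 q).ne',
          Real.log_rpow hT0]
        congr 1
        field_simp
    _ = ENNReal.log (ENNReal.ofReal (c * T ^ q)) / ((Real.log T : ℝ) : EReal) := by
        rw [ENNReal.log_ofReal_of_pos (by positivity)]
    _ ≤ _ := EReal.div_le_div_right_of_nonneg (by exact_mod_cast hlog.le)
        (ENNReal.log_monotone hT)

end

variable {τ : (ι → ℂ) →ₗ[ℂ] (ι → ℂ)} {V : ℤ → ℝ}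

theorem hasDerivAt_evolution (hpos : Function.Injective pos) (hτ : IsDirichletRestriction pos V τ)
    (n : ι) (t : ℝ) :
    HasDerivAt (fun t => evolution (ellTwoOperator τ) o pos t (pos n))
      (-(Complex.I * lineExpr V (evolution (ellTwoOperator τ) o pos t) (pos n))) t := by
  have hU := unitaryGroup_spec (hτ.exists_isUnitaryGroupOf hpos)
  have hgraph := (ellTwoOperator τ).mem_graph ⟨_, hτ.single_mem_domain hpos o⟩
  have hcoord := ((lp.evalCLM ℂ (fun _ : ι => ℂ) 2 n).restrictScalars ℝ).hasFDerivAt.comp_hasDerivAt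
    t (hU.hasDerivAt hgraph t)
  have hgen := congrFun (mem_graph_ellTwoOperator.1 (hU.map_graph hgraph t)) n
  simp only [evolution_apply hpos]
  exact hcoord.congr_deriv (congrArg (fun x => -(Complex.I * x)) (hgen.trans (hτ _ n)))

theorem norm_lineExpr_le (V : ℤ → ℝ) {u : ℤ → ℂ} {b : ℝ} (hb : ∀ k, ‖u k‖ ≤ b) (k : ℤ) :
    ‖lineExpr V u k‖ ≤ b + b + ‖(V k : ℂ)‖ * b :=
  norm_add_le_of_le (norm_add_le_of_le (hb _) (hb _)) (norm_mul_le_of_le le_rfl (hb k))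

theorem continuous_lineExpr (V : ℤ → ℝ) {ψ : ℝ → ℤ → ℂ} (hψ : ∀ k, Continuous fun t => ψ t k)
    (k : ℤ) : Continuous fun t => lineExpr V (ψ t) k :=
  ((hψ _).add (hψ _)).add ((hψ k).const_mul _)

theorem laplace_lineExpr (V : ℤ → ℝ) {ψ : ℝ → ℤ → ℂ} (hψ : ∀ k, Continuous fun t => ψ t k) {b : ℝ}
    (hb : ∀ k t, ‖ψ t k‖ ≤ b) {z : ℂ} (hz : 0 < z.im) (k : ℤ) :
    laplace (fun t => lineExpr V (ψ t) k) z =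
      lineExpr V (fun j => laplace (fun t => ψ t j) z) k := by
  simp only [lineExpr, LinearMap.coe_mk, AddHom.coe_mk]
  have hsum : Continuous fun t => ψ t (k - 1) + ψ t (k + 1) := (hψ _).add (hψ _)
  rw [laplace_add hsum (fun t => norm_add_le_of_le (hb _ t) (hb _ t))
      ((hψ k).const_mul _) (fun t => norm_mul_le_of_le le_rfl (hb k t)) hz,
    laplace_add (hψ _) (hb _) (hψ _) (hb _) hz, laplace_const_mul]

theorem lineExpr_resolventState (hpos : Function.Injective pos)
    (hτ : IsDirichletRestriction pos V τ) {z : ℂ} (hz : 0 < z.im) (n : ι) :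
    lineExpr V (resolventState (ellTwoOperator τ) o pos z) (pos n) =
      z * resolventState (ellTwoOperator τ) o pos z (pos n) -
        Complex.I * (if n = o then 1 else 0) := by
  have hU := hτ.exists_isUnitaryGroupOf hpos
  have hcont := continuous_evolution (o := o) hU hpos
  have hbound := norm_evolution_le (o := o) hU hpos
  calc lineExpr V (resolventState (ellTwoOperator τ) o pos z) (pos n)
      = laplace (fun t => lineExpr V (evolution (ellTwoOperator τ) o pos t) (pos n)) z :=
        (laplace_lineExpr V hcont hbound hz _).symm
    _ = z * resolventState (ellTwoOperator τ) o pos z (pos n) -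
          Complex.I * evolution (ellTwoOperator τ) o pos 0 (pos n) :=
        laplace_eq_of_hasDerivAt (hcont _) (hbound _) (continuous_lineExpr V hcont _)
          (fun t => norm_lineExpr_le V (hbound · t) _) (hasDerivAt_evolution hpos hτ n) hz
    _ = _ := by rw [evolution_zero_apply hU hpos]

end Dynamics

section Transfer

theorem norm_entry_le_l2_opNorm {m n : Type*} [Fintype m] [Fintype n] [DecidableEq n]
    (M : Matrix m n ℂ) (i : m) (j : n) : ‖M i j‖ ≤ ‖M‖ := by
  have hcol := M.l2_opNorm_mulVec (EuclideanSpace.single j (1 : ℂ))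
  have hentry := PiLp.norm_apply_le
    ((EuclideanSpace.equiv m ℂ).symm (M.mulVec (EuclideanSpace.single j (1 : ℂ)))) i
  simpa using hentry.trans hcol

theorem norm_inv_le_of_det_eq_one {M : Matrix (Fin 2) (Fin 2) ℂ} (hM : M.det = 1) :
    ‖M⁻¹‖ ≤ 3 * ‖M‖ := by
  -- the Cayley-Hamilton theorem
  have h : M⁻¹ = M.trace • (1 : Matrix (Fin 2) (Fin 2) ℂ) - M := by
    rw [Matrix.inv_def, hM, Ring.inverse_one, one_smul, Matrix.adjugate_fin_two,
      Matrix.trace_fin_two]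
    ext i j
    fin_cases i <;> fin_cases j <;> simp
  have htrace : ‖M.trace‖ ≤ ‖M‖ + ‖M‖ := by
    rw [Matrix.trace_fin_two]
    exact norm_add_le_of_le (norm_entry_le_l2_opNorm M 0 0) (norm_entry_le_l2_opNorm M 1 1)
  calc ‖M⁻¹‖ ≤ ‖M.trace • (1 : Matrix (Fin 2) (Fin 2) ℂ)‖ + ‖M‖ := h ▸ norm_sub_le _ _
    _ ≤ (‖M‖ + ‖M‖) + ‖M‖ := by rw [norm_smul, CStarRing.norm_one, mul_one]; gcongr
    _ = 3 * ‖M‖ := by ring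

variable (V : ℤ → ℝ) (n m : ℤ) (z : ℂ)

theorem det_stepMatrix : (stepMatrix V n z).det = 1 := by
  simp [stepMatrix, Matrix.det_fin_two]

theorem isUnit_det_stepMatrix : IsUnit (stepMatrix V n z).det :=
  det_stepMatrix V n z ▸ isUnit_one

theorem det_stepProd (k : ℕ) : (stepProd V m z k).det = 1 := by
  induction k with
  | zero => exact Matrix.det_one
  | succ k ih => rw [stepProd, Matrix.det_mul, det_stepMatrix, ih, one_mul]

theorem det_transferMatrix : (transferMatrix V n m z).det = 1 := by
  rw [transferMatrix]
  split_ifs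
  · exact det_stepProd V m z _
  · rw [Matrix.det_nonsing_inv, det_stepProd, Ring.inverse_one]

theorem isUnit_det_transferMatrix : IsUnit (transferMatrix V n m z).det :=
  det_transferMatrix V n m z ▸ isUnit_one

theorem stepProd_succ_right (k : ℕ) :
    stepProd V m z (k + 1) = stepProd V (m + 1) z k * stepMatrix V (m + 1) z := by
  induction k with
  | zero => simp [stepProd]
  | succ k ih =>
    have hsite : m + ((k + 1 + 1 : ℕ) : ℤ) = m + 1 + (k + 1 : ℕ) := by push_cast; ring
    rw [stepProd, ih, ← mul_assoc, hsite, ← stepProd]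

theorem transferMatrix_self : transferMatrix V n n z = 1 := by
  simp [transferMatrix, stepProd]

theorem transferMatrix_eq_stepMatrix_mul :
    transferMatrix V n m z = stepMatrix V n z * transferMatrix V (n - 1) m z := by
  rcases le_or_gt n m with hnm | hmn
  · have hlen : (m - (n - 1)).toNat = (m - n).toNat + 1 := by lia
    have hinv : transferMatrix V n m z = (stepProd V n z (m - n).toNat)⁻¹ := by
      rcases hnm.eq_or_lt with rfl | hlt
      · simp [transferMatrix_self, stepProd]
      · rw [transferMatrix, if_neg hlt.not_ge]
    rw [hinv, transferMatrix, if_neg (by lia), hlen, stepProd_succ_right, sub_add_cancel,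
      Matrix.mul_inv_rev, ← mul_assoc, Matrix.mul_nonsing_inv _ (isUnit_det_stepMatrix V n z),
      one_mul]
  · have hlen : (n - m).toNat = (n - 1 - m).toNat + 1 := by lia
    have hsite : m + (((n - 1 - m).toNat + 1 : ℕ) : ℤ) = n := by lia
    rw [transferMatrix, transferMatrix, if_pos hmn.le, if_pos (by lia), hlen, stepProd, hsite]

end Transfer

section Comparison

open Matrix (toEuclideanCLM)

theorem norm_le_exp_mul_of_norm_sub_le {F : Type*} [SeminormedAddCommGroup F] {y : ℕ → F} {κ : ℝ}
    {m : ℕ} (h : ∀ k < m, ‖y (k + 1) - y k‖ ≤ κ * ‖y (k + 1)‖) :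
    ‖y 0‖ ≤ Real.exp (κ * m) * ‖y m‖ := by
  induction m with
  | zero => simp
  | succ m ih =>
    have hstep : ‖y m‖ ≤ (κ + 1) * ‖y (m + 1)‖ := by
      linarith [h m m.lt_succ_self, norm_le_norm_add_norm_sub (y (m + 1)) (y m)]
    calc ‖y 0‖ ≤ Real.exp (κ * m) * ((κ + 1) * ‖y (m + 1)‖) :=
          (ih fun k hk => h k (hk.trans m.lt_succ_self)).trans (by gcongr)
      _ ≤ Real.exp (κ * m) * (Real.exp κ * ‖y (m + 1)‖) := by
        gcongr
        exact Real.add_one_le_exp κ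
      _ = Real.exp (κ * (m + 1 : ℕ)) * ‖y (m + 1)‖ := by
        rw [← mul_assoc, ← Real.exp_add, Nat.cast_succ, mul_add_one]

/-- The vector `(u(n+1), u(n))`, on which the transfer matrices act, with its Euclidean norm. -/
def stateVec (u : ℤ → ℂ) (n : ℤ) : EuclideanSpace ℂ (Fin 2) := !₂[u (n + 1), u n]

theorem norm_apply_le_norm_stateVec (u : ℤ → ℂ) (n : ℤ) : ‖u n‖ ≤ ‖stateVec u n‖ :=
  PiLp.norm_apply_le (stateVec u n) 1

theorem norm_apply_add_one_le_norm_stateVec (u : ℤ → ℂ) (n : ℤ) :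
    ‖u (n + 1)‖ ≤ ‖stateVec u n‖ :=
  PiLp.norm_apply_le (stateVec u n) 0

theorem norm_stateVec_sq (u : ℤ → ℂ) (n : ℤ) :
    ‖stateVec u n‖ ^ 2 = ‖u (n + 1)‖ ^ 2 + ‖u n‖ ^ 2 := by
  simp [EuclideanSpace.norm_sq_eq, Fin.sum_univ_two, stateVec]

/-- The vector `(u(n+1), u(n))` transported back to the site `1` at the energy `E`; it does not
depend on `n` when `u` solves the stationary equation at the energy `E`. -/
def reducedVec (V : ℤ → ℝ) (E : ℂ) (u : ℤ → ℂ) (n : ℤ) : EuclideanSpace ℂ (Fin 2) :=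
  toEuclideanCLM (𝕜 := ℂ) (transferMatrix V n 1 E)⁻¹ (stateVec u n)

variable {V : ℤ → ℝ} {E z : ℂ} {u : ℤ → ℂ} {C : ℝ} {a b n m : ℤ}

theorem norm_toEuclideanCLM_inv_transferMatrix_le (h : ‖transferMatrix V n 1 E‖ ≤ C)
    (v : EuclideanSpace ℂ (Fin 2)) :
    ‖toEuclideanCLM (𝕜 := ℂ) (transferMatrix V n 1 E)⁻¹ v‖ ≤ 3 * C * ‖v‖ := by
  refine ContinuousLinearMap.le_of_opNorm_le _ ?_ v
  rw [Matrix.l2_opNorm_toEuclideanCLM]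
  exact (norm_inv_le_of_det_eq_one (det_transferMatrix V n 1 E)).trans (by gcongr)

theorem norm_stateVec_le (h : ‖transferMatrix V n 1 E‖ ≤ C) :
    ‖stateVec u n‖ ≤ C * ‖reducedVec V E u n‖ := by
  have hstate : stateVec u n =
      toEuclideanCLM (𝕜 := ℂ) (transferMatrix V n 1 E) (reducedVec V E u n) := by
    rw [reducedVec, ← mul_apply_eq_comp, ← map_mul,
      Matrix.mul_nonsing_inv _ (isUnit_det_transferMatrix V n 1 E), map_one,
      one_apply_eq_self]
  rw [hstate]
  exact ContinuousLinearMap.le_of_opNorm_le _ h _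

theorem reducedVec_sub (hu : lineExpr V u n = z * u n) :
    reducedVec V E u n - reducedVec V E u (n - 1) =
      toEuclideanCLM (𝕜 := ℂ) (transferMatrix V n 1 E)⁻¹ !₂[(z - E) * u n, 0] := by
  have hprev : reducedVec V E u (n - 1) = toEuclideanCLM (𝕜 := ℂ) (transferMatrix V n 1 E)⁻¹
      (toEuclideanCLM (𝕜 := ℂ) (stepMatrix V n E) (stateVec u (n - 1))) := by
    rw [reducedVec, transferMatrix_eq_stepMatrix_mul V n, Matrix.mul_inv_rev,
      ← mul_apply_eq_comp, ← map_mul, mul_assoc,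
      Matrix.nonsing_inv_mul _ (isUnit_det_stepMatrix V n E), mul_one]
  have hnext : u (n + 1) = (z - V n) * u n - u (n - 1) := by
    have heq : u (n - 1) + u (n + 1) + V n * u n = z * u n := hu
    linear_combination heq
  rw [hprev, reducedVec, ← map_sub]
  congr 1
  ext i
  fin_cases i
  · have htop : u (n + 1) - (u n * (E - V n) - u (n - 1)) = (z - E) * u n := by
      linear_combination hnext
    simpa [stateVec, stepMatrix, sub_eq_add_neg] using htop
  · simp [stateVec, stepMatrix]

theorem norm_reducedVec_sub_le (h : ‖transferMatrix V n 1 E‖ ≤ C)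
    (hu : lineExpr V u n = z * u n) :
    ‖reducedVec V E u n - reducedVec V E u (n - 1)‖ ≤ 3 * C * (‖z - E‖ * ‖u n‖) := by
  have hnorm : ‖!₂[(z - E) * u n, 0]‖ = ‖z - E‖ * ‖u n‖ := by
    simp [EuclideanSpace.norm_eq, Fin.sum_univ_two, mul_nonneg]
  rw [reducedVec_sub hu, ← hnorm]
  exact norm_toEuclideanCLM_inv_transferMatrix_le h _

/-- `u n` is a coordinate of the state vectors at `n` and at `n - 1`, so that the increment of the
reduced vector is controlled at both of its ends and the estimate can be iterated both ways. -/
theorem norm_reducedVec_sub_le_min (h : ‖transferMatrix V n 1 E‖ ≤ C)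
    (h' : ‖transferMatrix V (n - 1) 1 E‖ ≤ C) (hu : lineExpr V u n = z * u n) :
    ‖reducedVec V E u n - reducedVec V E u (n - 1)‖ ≤
      3 * C ^ 2 * ‖z - E‖ * min ‖reducedVec V E u n‖ ‖reducedVec V E u (n - 1)‖ := by
  have hC : 0 ≤ C := (norm_nonneg _).trans h
  have hright : ‖u n‖ ≤ C * ‖reducedVec V E u n‖ :=
    (norm_apply_le_norm_stateVec u n).trans (norm_stateVec_le h)
  have hleft : ‖u n‖ ≤ C * ‖reducedVec V E u (n - 1)‖ := by
    refine le_trans ?_ (norm_stateVec_le h')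
    simpa using norm_apply_add_one_le_norm_stateVec u (n - 1)
  calc _ ≤ 3 * C * (‖z - E‖ * ‖u n‖) := norm_reducedVec_sub_le h hu
    _ ≤ 3 * C * (‖z - E‖ *
        (C * min ‖reducedVec V E u n‖ ‖reducedVec V E u (n - 1)‖)) := by
      rw [mul_min_of_nonneg _ _ hC]
      gcongr
      exact le_min hright hleft
    _ = _ := by ring

theorem norm_reducedVec_le_exp_mul (hT : ∀ k ∈ Set.Icc a b, ‖transferMatrix V k 1 E‖ ≤ C)
    (hu : ∀ k ∈ Set.Ioc a b, lineExpr V u k = z * u k) (hm : m ∈ Set.Icc a b)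
    (hn : n ∈ Set.Icc a b) :
    ‖reducedVec V E u m‖ ≤
      Real.exp (3 * C ^ 2 * ‖z - E‖ * (m - n).natAbs) * ‖reducedVec V E u n‖ := by
  obtain ⟨ham, hmb⟩ := hm
  obtain ⟨han, hnb⟩ := hn
  have hstep : ∀ k ∈ Set.Ioc a b, ‖reducedVec V E u k - reducedVec V E u (k - 1)‖ ≤
      3 * C ^ 2 * ‖z - E‖ * min ‖reducedVec V E u k‖ ‖reducedVec V E u (k - 1)‖ :=
    fun k hk => norm_reducedVec_sub_le_min (hT k ⟨hk.1.le, hk.2⟩)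
      (hT (k - 1) ⟨Int.le_sub_one_of_lt hk.1, by linarith [hk.2]⟩) (hu k hk)
  rcases le_total m n with hmn | hnm
  · obtain ⟨d, rfl⟩ := Int.le.dest hmn
    have h := norm_le_exp_mul_of_norm_sub_le (m := d) (κ := 3 * C ^ 2 * ‖z - E‖)
      (y := fun k : ℕ => reducedVec V E u (m + k)) fun k hk => by
        have hk' := hstep (m + (k + 1 : ℕ)) ⟨by lia, by lia⟩
        rw [Nat.cast_succ, ← add_assoc, add_sub_cancel_right] at hk'
        rw [Nat.cast_succ, ← add_assoc]
        exact hk'.trans (by gcongr; exact min_le_left _ _)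
    simpa using h
  · obtain ⟨d, rfl⟩ := Int.le.dest hnm
    have h := norm_le_exp_mul_of_norm_sub_le (m := d) (κ := 3 * C ^ 2 * ‖z - E‖)
      (y := fun k : ℕ => reducedVec V E u (n + d - k)) fun k hk => by
        have hk' := hstep (n + d - k) ⟨by lia, by lia⟩
        rw [norm_sub_rev, sub_sub] at hk'
        rw [Nat.cast_succ]
        exact hk'.trans (by gcongr; exact min_le_right _ _)
    simpa using h

theorem norm_stateVec_le_mul_norm_stateVec
    (hT : ∀ k ∈ Set.Icc a b, ‖transferMatrix V k 1 E‖ ≤ C)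
    (hu : ∀ k ∈ Set.Ioc a b, lineExpr V u k = z * u k) (hz : ‖z - E‖ * (b - a) ≤ 1)
    (hm : m ∈ Set.Icc a b) (hn : n ∈ Set.Icc a b) :
    ‖stateVec u m‖ ≤ 3 * C ^ 2 * Real.exp (3 * C ^ 2) * ‖stateVec u n‖ := by
  have hC : 0 ≤ C := (norm_nonneg _).trans (hT m hm)
  have hdist : ((m - n).natAbs : ℝ) ≤ b - a := by
    rw [Nat.cast_natAbs]
    exact_mod_cast abs_sub_le_of_le_of_le hm.1 hm.2 hn.1 hn.2
  have hexp : 3 * C ^ 2 * ‖z - E‖ * (m - n).natAbs ≤ 3 * C ^ 2 := by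
    rw [mul_assoc]
    exact mul_le_of_le_one_right (by positivity) (hz.trans' (by gcongr))
  calc ‖stateVec u m‖ ≤ C * ‖reducedVec V E u m‖ := norm_stateVec_le (hT m hm)
    _ ≤ C * (Real.exp (3 * C ^ 2) * ‖reducedVec V E u n‖) := by
      gcongr
      exact (norm_reducedVec_le_exp_mul hT hu hm hn).trans (by gcongr)
    _ ≤ C * (Real.exp (3 * C ^ 2) * (3 * C * ‖stateVec u n‖)) := by
      gcongr
      exact norm_toEuclideanCLM_inv_transferMatrix_le (hT n hn) _
    _ = _ := by ring

end Comparison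

section Annulus

/-- The sites at distance between `K` and `2K` from the origin. -/
def annulus (K : ℕ) : Finset ℤ := (Finset.Icc (-(2 * K) : ℤ) (2 * K)).filter fun n => K ≤ |n|

variable {V : ℤ → ℝ} {E z : ℂ} {u : ℤ → ℂ} {C M s : ℝ} {a b n m : ℤ} {K : ℕ}

theorem mem_annulus : n ∈ annulus K ↔ (K : ℤ) ≤ |n| ∧ |n| ≤ 2 * K := by
  rw [annulus, Finset.mem_filter, Finset.mem_Icc, ← abs_le, and_comm]

theorem mul_le_sum_norm_sq_of_le_norm_stateVec {S : Finset ℤ} (hs : 0 ≤ s)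
    (hS : Finset.Icc a (a + K) ⊆ S) (h : ∀ n ∈ Finset.Ico a (a + K), s ≤ ‖stateVec u n‖) :
    s ^ 2 / 2 * K ≤ ∑ n ∈ S, ‖u n‖ ^ 2 := by
  have hsub : ∀ S' ⊆ Finset.Icc a (a + K), ∑ n ∈ S', ‖u n‖ ^ 2 ≤ ∑ n ∈ S, ‖u n‖ ^ 2 :=
    fun S' hS' => Finset.sum_le_sum_of_subset_of_nonneg (hS'.trans hS) fun _ _ _ => by positivity
  have hnext : ∑ n ∈ Finset.Ico a (a + K), ‖u (n + 1)‖ ^ 2 ≤ ∑ n ∈ S, ‖u n‖ ^ 2 := by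
    rw [Finset.sum_Ico_add' (fun n => ‖u n‖ ^ 2)]
    exact hsub _ fun n hn => by simp only [Finset.mem_Ico, Finset.mem_Icc] at hn ⊢; lia
  have hpair : K * s ^ 2 ≤ ∑ n ∈ Finset.Ico a (a + K), (‖u (n + 1)‖ ^ 2 + ‖u n‖ ^ 2) := by
    calc K * s ^ 2 = ∑ _n ∈ Finset.Ico a (a + K), s ^ 2 := by simp
      _ ≤ _ := Finset.sum_le_sum fun n hn => by
        rw [← norm_stateVec_sq]
        gcongr
        exact h n hn
  rw [Finset.sum_add_distrib] at hpair
  linarith [hsub _ Finset.Ico_subset_Icc_self]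

theorem mul_le_sum_norm_sq_of_norm_transferMatrix_le {S : Finset ℤ} {c : ℤ} (hC : 0 < C)
    (hT : ∀ k ∈ Set.Icc a b, ‖transferMatrix V k 1 E‖ ≤ C)
    (hu : ∀ k ∈ Set.Ioc a b, lineExpr V u k = z * u k) (hz : ‖z - E‖ * (b - a) ≤ 1)
    (hm : m ∈ Set.Icc a b) (hs : 0 ≤ s) (hsm : s ≤ ‖stateVec u m‖) (hac : a ≤ c)
    (hcb : c + K ≤ b) (hS : Finset.Icc c (c + K) ⊆ S) :
    (s / (3 * C ^ 2 * Real.exp (3 * C ^ 2))) ^ 2 / 2 * K ≤ ∑ n ∈ S, ‖u n‖ ^ 2 := by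
  refine mul_le_sum_norm_sq_of_le_norm_stateVec (by positivity) hS fun n hn => ?_
  obtain ⟨hcn, hnc⟩ := Finset.mem_Ico.1 hn
  rw [div_le_iff₀' (by positivity)]
  exact hsm.trans (norm_stateVec_le_mul_norm_stateVec hT hu hz hm ⟨by lia, by lia⟩)

theorem one_le_norm_stateVec_add_of_source (hu : lineExpr V u 1 = z * u 1 - Complex.I)
    (hM : ‖z - V 1‖ ≤ M) : 1 ≤ (1 + M) * ‖stateVec u 1‖ + ‖stateVec u (-1)‖ := by
  have hM0 : 0 ≤ M := (norm_nonneg _).trans hM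
  have hsource : Complex.I = (z - V 1) * u 1 - u (1 + 1) - u (-1 + 1) := by
    have heq : u (-1 + 1) + u (1 + 1) + V 1 * u 1 = z * u 1 - Complex.I := hu
    linear_combination heq
  calc 1 = ‖(z - V 1) * u 1 - u (1 + 1) - u (-1 + 1)‖ := by rw [← hsource, Complex.norm_I]
    _ ≤ ‖z - V 1‖ * ‖u 1‖ + ‖u (1 + 1)‖ + ‖u (-1 + 1)‖ :=
      norm_sub_le_of_le (norm_sub_le_of_le (norm_mul_le _ _) le_rfl) le_rfl
    _ ≤ M * ‖stateVec u 1‖ + ‖stateVec u 1‖ + ‖stateVec u (-1)‖ := by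
      gcongr
      · exact norm_apply_le_norm_stateVec u 1
      · exact norm_apply_add_one_le_norm_stateVec u 1
      · exact norm_apply_add_one_le_norm_stateVec u (-1)
    _ = _ := by ring

theorem one_div_le_norm_stateVec_or_of_source
    (hu : lineExpr V u 1 = z * u 1 - Complex.I) (hM : ‖z - V 1‖ ≤ M) :
    1 / (2 + M) ≤ ‖stateVec u 1‖ ∨ 1 / (2 + M) ≤ ‖stateVec u (-1)‖ := by
  have hM0 : 0 ≤ M := (norm_nonneg _).trans hM
  have hsource := one_le_norm_stateVec_add_of_source hu hM
  by_contra! hsmall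
  have hone : (1 + M) * (1 / (2 + M)) + 1 / (2 + M) = 1 := by field_simp; ring
  nlinarith [hsmall.1, hsmall.2]

theorem mul_le_sum_annulus_norm_sq {R : Set ℤ} (hR : R = Set.univ ∨ R = Set.Ioi 0)
    (hzero : ∀ n ∉ R, u n = 0)
    (hu : ∀ n ∈ R, lineExpr V u n = z * u n - Complex.I * if n = 1 then 1 else 0)
    (hC : 0 < C) (hT : ∀ n ∈ R, n ≠ 0 → |n| ≤ 2 * K → ‖transferMatrix V n 1 E‖ ≤ C)
    (hM : ‖z - V 1‖ ≤ M) (hK : 1 ≤ K) (hz : ‖z - E‖ * (2 * K) ≤ 1) :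
    (1 / (2 + M) / (3 * C ^ 2 * Real.exp (3 * C ^ 2))) ^ 2 / 2 * K ≤
      ∑ n ∈ annulus K, ‖u n‖ ^ 2 := by
  have hM0 : 0 ≤ M := (norm_nonneg _).trans hM
  have hpos : ∀ n : ℤ, 0 < n → n ∈ R := fun n hn => by rcases hR with rfl | rfl <;> simp [hn]
  have hfree : ∀ n ∈ R, n ≠ 1 → lineExpr V u n = z * u n := fun n hn hn1 => by
    simpa [hn1] using hu n hn
  have hz' : ‖z - E‖ * (2 * K - 1) ≤ 1 := hz.trans' (by gcongr; exact sub_le_self _ zero_le_one)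
  rcases one_div_le_norm_stateVec_or_of_source (by simpa using hu 1 (hpos 1 one_pos)) hM with
    hright | hleft
  · refine mul_le_sum_norm_sq_of_norm_transferMatrix_le (a := 1) (b := 2 * K) (c := K) hC
      (fun k hk => ?_) (fun k hk => hfree k (hpos k ?_) ?_) (by push_cast; exact hz')
      ⟨le_rfl, by lia⟩ (by positivity) hright (by lia) (by lia) fun n hn => ?_
    · obtain ⟨hk1, hkK⟩ := hk
      exact hT k (hpos k hk1) (by lia) (abs_le.2 ⟨by lia, hkK⟩)
    · linarith [hk.1]
    · exact hk.1.ne'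
    · rw [Finset.mem_Icc] at hn
      exact mem_annulus.2 ⟨le_abs.2 (.inl hn.1), abs_le.2 ⟨by lia, by lia⟩⟩
  · obtain rfl : R = Set.univ := hR.resolve_right fun hhalf => by
      have hvanish : stateVec u (-1) = 0 := by
        ext i
        fin_cases i <;> simp [stateVec, hzero, hhalf]
      have hpos' : 0 < 1 / (2 + M) := by positivity
      rw [hvanish, norm_zero] at hleft
      exact hleft.not_gt hpos'
    refine mul_le_sum_norm_sq_of_norm_transferMatrix_le (a := -(2 * K)) (b := -1) (c := -(2 * K))
      hC (fun k hk => ?_) (fun k hk => hfree k trivial ?_) (by push_cast; linarith)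
      ⟨by lia, le_rfl⟩ (by positivity) hleft le_rfl (by lia) fun n hn => ?_
    · obtain ⟨hkK, hk1⟩ := hk
      exact hT k trivial (by lia) (abs_le.2 ⟨by lia, by lia⟩)
    · linarith [hk.2]
    · rw [Finset.mem_Icc] at hn
      exact mem_annulus.2 ⟨le_abs.2 (.inr (by lia)), abs_le.2 ⟨by lia, by lia⟩⟩

end Annulus

section Growth

theorem natFloor_half_mem_Icc {T : ℝ} (hT : 4 ≤ T) :
    (⌊T / 2⌋₊ : ℝ) ∈ Set.Icc (T / 4) (T / 2) :=
  ⟨by linarith [Nat.lt_floor_add_one (T / 2)], Nat.floor_le (by linarith)⟩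

theorem mul_abs_rpow_le_one {T θ x m : ℝ} (hT : 0 < T) (hθ : 0 < θ) (hx : |x| ≤ T ^ (-(1 / θ)))
    (hm : m ≤ T) : m * |x| ^ θ ≤ 1 := by
  have hpow : |x| ^ θ ≤ T⁻¹ := by
    calc |x| ^ θ ≤ (T ^ (-(1 / θ))) ^ θ := by gcongr
      _ = T⁻¹ := by
        rw [← Real.rpow_mul hT.le, neg_mul, one_div_mul_cancel hθ.ne', Real.rpow_neg_one]
  calc m * |x| ^ θ ≤ T * T⁻¹ := by gcongr
    _ = 1 := mul_inv_cancel₀ hT.ne'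

variable {ι : Type} [DecidableEq ι] {o : ι} {pos : ι → ℤ}

theorem le_betaMinus_of_resolventState {H : EllTwo ι →ₗ.[ℂ] EllTwo ι} {p q c E₀ : ℝ}
    {S : ℕ → Finset ι} (hU : ∃ U, IsUnitaryGroupOf H U) (hpos : Function.Injective pos) (hp : 0 ≤ p)
    (hc : 0 < c) (hS : ∀ K, ∀ n ∈ S K, (K : ℤ) ≤ |pos n|)
    (h : ∀ (K : ℕ) (T E : ℝ), 1 ≤ K → 2 * K ≤ T → |E - E₀| ≤ T ^ (-q) →
      c * K ≤ ∑ n ∈ S K, ‖resolventState H o pos (E + Complex.I * (1 / T : ℝ)) (pos n)‖ ^ 2) :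
    ((p - q : ℝ) : EReal) ≤ betaMinus H o pos p := by
  refine le_betaMinus (c := (1 / 4) ^ p * (c / (4 * Real.pi))) (by positivity) ?_
  filter_upwards [eventually_ge_atTop 4] with T hT
  have hT0 : 0 < T := by linarith
  obtain ⟨hKT, hKT'⟩ := natFloor_half_mem_Icc hT
  set K : ℕ := ⌊T / 2⌋₊
  have hK : 1 ≤ K := by exact_mod_cast (by linarith : (1 : ℝ) ≤ K)
  have hmoment := le_moment hU hpos hT0 hp K.cast_nonneg
    (fun n hn => by exact_mod_cast hS K n hn) measurableSet_Icc fun E hE =>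
      h K T E hK (by linarith) (by rwa [abs_sub_comm, Set.mem_Icc_iff_abs_le])
  have hvolume : E₀ + T ^ (-q) - (E₀ - T ^ (-q)) = 2 * T ^ (-q) := by ring
  rw [Real.volume_Icc, hvolume, ← ENNReal.ofReal_mul (by positivity),
    ← ENNReal.ofReal_mul (by positivity), ← ENNReal.ofReal_mul (by positivity)] at hmoment
  refine (ENNReal.ofReal_le_ofReal ?_).trans hmoment
  calc (1 / 4) ^ p * (c / (4 * Real.pi)) * T ^ (p - q)
      = (T / 4) ^ p * (1 / (2 * Real.pi * T) * (c * (T / 4) * (2 * T ^ (-q)))) := by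
        rw [sub_eq_add_neg, Real.rpow_add hT0, div_eq_mul_one_div T 4,
          Real.mul_rpow hT0.le (by norm_num)]
        field_simp
    _ ≤ (K : ℝ) ^ p * (1 / (2 * Real.pi * T) * (c * K * (2 * T ^ (-q)))) := by gcongr

variable {V : ℤ → ℝ} {τ : (ι → ℂ) →ₗ[ℂ] (ι → ℂ)} {C E₀ θ p : ℝ}

theorem mul_le_sum_annulus_norm_sq_resolventState {T E M : ℝ} {K : ℕ}
    (hpos : Function.Injective pos) (ho : pos o = 1)
    (hR : Set.range pos = Set.univ ∨ Set.range pos = Set.Ioi 0)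
    (hτ : IsDirichletRestriction pos V τ) (hC : 0 < C)
    (hT : ∀ n ∈ Set.range pos, n ≠ 0 → |n| ≤ 2 * K → ‖transferMatrix V n 1 E‖ ≤ C)
    (hM : |E| + |V 1| + 1 ≤ M) (hK : 1 ≤ K) (hKT : 2 * K ≤ T) :
    (1 / (2 + M) / (3 * C ^ 2 * Real.exp (3 * C ^ 2))) ^ 2 / 2 * K ≤ ∑ n ∈ annulus K,
      ‖resolventState (ellTwoOperator τ) o pos (E + Complex.I * (1 / T : ℝ)) n‖ ^ 2 := by
  have hT1 : 1 ≤ T := by linarith [(Nat.one_le_cast (α := ℝ)).2 hK]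
  have hT0 : 0 < T := one_pos.trans_le hT1
  have hdamping : ‖Complex.I * (1 / T : ℝ)‖ = 1 / T := by
    rw [norm_mul, Complex.norm_I, one_mul, Complex.norm_real, Real.norm_of_nonneg (by positivity)]
  refine mul_le_sum_annulus_norm_sq (z := E + Complex.I * (1 / T : ℝ)) hR
    (fun k hk => resolventState_of_notMem_range hk _) ?_ hC hT ?_ hK ?_
  · rintro _ ⟨n, rfl⟩
    rw [lineExpr_resolventState hpos hτ (by simpa using hT0), ← ho]
    simp only [hpos.eq_iff]
  · calc ‖(E + Complex.I * (1 / T : ℝ) - V 1 : ℂ)‖ ≤ |E| + 1 / T + |V 1| := by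
          refine norm_sub_le_of_le (norm_add_le_of_le ?_ hdamping.le) ?_ <;>
            rw [Complex.norm_real, Real.norm_eq_abs]
      _ ≤ |E| + 1 + |V 1| := by gcongr; exact div_le_one_of_le₀ hT1 hT0.le
      _ ≤ M := by linarith
  · rwa [add_sub_cancel_left, hdamping, one_div_mul_eq_div, div_le_one hT0]

theorem sub_le_betaMinus_of_norm_transferMatrix_le (hpos : Function.Injective pos) (ho : pos o = 1)
    (hR : Set.range pos = Set.univ ∨ Set.range pos = Set.Ioi 0)
    (hτ : IsDirichletRestriction pos V τ) (hθ : 0 < θ) (hp : 0 ≤ p)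
    (hT : ∀ n ∈ Set.range pos, ∀ E : ℝ, n ≠ 0 → |(n : ℝ)| * |E - E₀| ^ θ ≤ 1 →
      ‖transferMatrix V n 1 E‖ ≤ C) :
    ((p - 1 / θ : ℝ) : EReal) ≤ betaMinus (ellTwoOperator τ) o pos p := by
  have hC : 0 < C := by
    have hone := hT 1 ⟨o, ho⟩ E₀ one_ne_zero (by simp [hθ.ne'])
    rw [transferMatrix_self, CStarRing.norm_one] at hone
    exact one_pos.trans_le hone
  refine le_betaMinus_of_resolventState (E₀ := E₀)
    (S := fun K => (annulus K).preimage pos hpos.injOn)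
    (c := (1 / (2 + (|E₀| + |V 1| + 2)) / (3 * C ^ 2 * Real.exp (3 * C ^ 2))) ^ 2 / 2)
    (hτ.exists_isUnitaryGroupOf hpos) hpos hp (by positivity)
    (fun K n hn => (mem_annulus.1 (Finset.mem_preimage.1 hn)).1) fun K T E hK hKT hE => ?_
  have hT1 : 1 ≤ T := by linarith [(Nat.one_le_cast (α := ℝ)).2 hK]
  have hE1 : |E - E₀| ≤ 1 :=
    hE.trans (Real.rpow_le_one_of_one_le_of_nonpos hT1 (by simp [hθ.le]))
  rw [Finset.sum_preimage pos _ hpos.injOn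
    (fun k => ‖resolventState (ellTwoOperator τ) o pos _ k‖ ^ 2) fun k _ hk => by
      rw [resolventState_of_notMem_range hk, norm_zero, zero_pow two_ne_zero]]
  refine mul_le_sum_annulus_norm_sq_resolventState hpos ho hR hτ hC (fun n hn hn0 hnK => ?_) ?_
    hK hKT
  · exact hT n hn E hn0 (mul_abs_rpow_le_one (by linarith) hθ hE
      (hKT.trans' (by exact_mod_cast hnK)))
  · linarith [abs_sub_abs_le_abs_sub E E₀]

end Growth

section Instances

theorem isDirichletRestriction_lineExpr (V : ℤ → ℝ) :
    IsDirichletRestriction (fun n : ℤ => n) V (lineExpr V) := fun f n => by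
  rw [show (fun n : ℤ => n) = id from rfl, Function.extend_id]
  rfl

theorem range_coe_pnat : Set.range (fun n : ℕ+ => (n : ℤ)) = Set.Ioi 0 := by
  ext k
  refine ⟨?_, fun hk => ⟨⟨k.toNat, by simpa using hk⟩, Int.toNat_of_nonneg (le_of_lt hk)⟩⟩
  rintro ⟨n, rfl⟩
  exact Int.natCast_pos.2 n.pos

theorem coe_pnat_injective : Function.Injective fun n : ℕ+ => (n : ℤ) :=
  Nat.cast_injective.comp PNat.coe_injective

theorem isDirichletRestriction_halfLineExpr (V : ℕ+ → ℝ) :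
    IsDirichletRestriction (fun n : ℕ+ => (n : ℤ))
      (Function.extend (fun n : ℕ+ => (n : ℤ)) V 0) (halfLineExpr V) := fun f n => by
  have hnext : Function.extend (fun n : ℕ+ => (n : ℤ)) f 0 (n + 1) = f (n + 1) := by
    exact_mod_cast coe_pnat_injective.extend_apply f 0 (n + 1)
  have hprev : Function.extend (fun n : ℕ+ => (n : ℤ)) f 0 (n - 1) =
      if n = 1 then 0 else f (n - 1) := by
    split_ifs with hn
    · refine Function.extend_apply' _ _ _ ?_
      rw [← Set.mem_range, range_coe_pnat]
      simp [hn]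
    · obtain ⟨m, rfl⟩ := PNat.exists_eq_succ_of_ne_one hn
      rw [PNat.add_sub, ← coe_pnat_injective.extend_apply f 0 m]
      simp
  simp only [halfLineExpr, lineExpr, LinearMap.coe_mk, AddHom.coe_mk, hnext, hprev,
    coe_pnat_injective.extend_apply]

end Instances

theorem corollary2_general (C E₀ θ : ℝ) (hθ : 0 < θ) :
    (∀ V : ℤ → ℝ,
      (∀ (n : ℤ) (E : ℝ), n ≠ 0 → |(n : ℝ)| * |E - E₀| ^ θ ≤ 1 →
        ‖transferMatrix V n 1 (E : ℂ)‖ ≤ C) →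
      ∀ p : ℝ, 0 ≤ p → ((p - 1 / θ : ℝ) : EReal) ≤ lineBetaMinus V p) ∧
    (∀ V : ℕ+ → ℝ,
      (∀ (n : ℕ+) (E : ℝ), |(n : ℝ)| * |E - E₀| ^ θ ≤ 1 →
        ‖halfLineTransferMatrix V n 1 (E : ℂ)‖ ≤ C) →
      ∀ p : ℝ, 0 ≤ p → ((p - 1 / θ : ℝ) : EReal) ≤ halfLineBetaMinus V p) := by
  refine ⟨fun V hT p hp => ?_, fun V hT p hp => ?_⟩
  · exact sub_le_betaMinus_of_norm_transferMatrix_le Function.injective_id rfl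
      (.inl Set.range_id) (isDirichletRestriction_lineExpr V) hθ hp fun n _ => hT n
  · refine sub_le_betaMinus_of_norm_transferMatrix_le (C := C) (E₀ := E₀) coe_pnat_injective rfl
      (.inr range_coe_pnat) (isDirichletRestriction_halfLineExpr V) hθ hp ?_
    rintro _ ⟨n, rfl⟩ E -
    exact hT n E

end

theorem corollary2 (C E₀ θ : ℝ) (hC : 0 < C) (hθ : 1 ≤ θ) :
    (∀ V : ℤ → ℝ,
      (∀ (n : ℤ) (E : ℝ), n ≠ 0 → |(n : ℝ)| * |E - E₀| ^ θ ≤ 1 →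
        ‖transferMatrix V n 1 (E : ℂ)‖ ≤ C) →
      ∀ p : ℝ, 0 < p → ((p - 1 / θ : ℝ) : EReal) ≤ lineBetaMinus V p) ∧
    (∀ V : ℕ+ → ℝ,
      (∀ (n : ℕ+) (E : ℝ), |(n : ℝ)| * |E - E₀| ^ θ ≤ 1 →
        ‖halfLineTransferMatrix V n 1 (E : ℂ)‖ ≤ C) →
      ∀ p : ℝ, 0 < p → ((p - 1 / θ : ℝ) : EReal) ≤ halfLineBetaMinus V p) :=
  (corollary2_general C E₀ θ (one_pos.trans_le hθ)).imp
    (fun h V hV p hp => h V hV p hp.le) fun h V hV p hp => h V hV p hp.le
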